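/- Let $M$ be a smooth manifold. A Born structure on $M$ is a triple $(g,h,\omega)$ consisting of two pseudo-Riemannian metrics $g,h$ (of arbitrary signature) and a non-degenerate 2-form $\omega$, such that the endomorphism fields $A,B,J$ of $TM$ determined by $$g(AX,Y)=\omega(X,Y),\qquad g(BX,Y)=h(X,Y),\qquad \omega(-JX,Y)=h(X,Y)$$ satisfy $A^2=B^2=-J^2=\mathrm{Id}$. It is called integrable if $d\omega=0$ and at least two of $A,B,J$ are integrable, i.e. have vanishing Nijenhuis tensor $N_T(X,Y)=[TX,TY]+T^2[X,Y]-T[TX,Y]-T[X,TY]$. Let $L_\pm$ be the $(\pm1)$-eigenbundles of $A$. The Künneth connection $\nabla^K$ is the unique affine connection that preserves $L_+$ and $L_-$, satisfies $\nabla^K\omega=0$, and has vanishing mixed torsion: $T^K(X,Y)=0$ whenever $X\in L_+$, $Y\in L_-$ or vice versa. Let $\nabla^g$ be the Levi-Civita connection of $g$ and $\nabla^c_XY=\tfrac12(\nabla^g_XY+A\nabla^g_X AY)$ the canonical connection. An affine connection $\nabla$ has vanishing generalized torsion if $$g(\nabla_XY-\nabla_YX,Z)+g(\nabla_ZX,Y)=g(\nabla^c_XY-\nabla^c_YX,Z)+g(\nabla^c_ZX,Y)$$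 for all $X,Y,Z\in\mathfrak X(M)$. The Born connection $\nabla^B$ is the unique affine connection that satisfies $\nabla^Bg=\nabla^Bh=\nabla^B\omega=0$ and has vanishing generalized torsion. **Theorem.** Let $(g,h,\omega)$ be an integrable Born structure on $M$. Then $\nabla^g$, $\nabla^K$ and $\nabla^B$ exist and are unique, and for all $X,Y\in\mathfrak X(M)$ $$\nabla^B_XY=\tfrac12\left(\nabla^K_XY+B\nabla^K_X BY\right)=\tfrac12\left(\nabla^K_XY-J\nabla^K_X JY\right).$$ -/

import Mathlib

open Bundle
open scoped Manifold ContDiff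

noncomputable section

namespace BornGeometry

/-! ## Vector fields and forms on a smooth manifold

Throughout, `M` is a smooth manifold without boundary, modelled on a finite-dimensional real
vector space `E`. -/

section Fields

variable (E : Type*) [NormedAddCommGroup E] [NormedSpace ℝ E]
  (M : Type*) [TopologicalSpace M] [ChartedSpace E M] [IsManifold 𝓘(ℝ, E) ∞ M]

/-- Rough vector fields on `M`. -/
abbrev VField : Type _ := ∀ x : M, TangentSpace 𝓘(ℝ, E) x

/-- Rough fields of endomorphisms of the tangent bundle of `M`. -/
abbrev EndField : Type _ := ∀ x : M, TangentSpace 𝓘(ℝ, E) x →L[ℝ] TangentSpace 𝓘(ℝ, E) x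

variable {E M}

/-- `X` is a smooth vector field, that is, `X ∈ 𝔛(M)`. -/
def IsSmooth (X : VField E M) : Prop :=
  ContMDiff 𝓘(ℝ, E) (𝓘(ℝ, E).prod 𝓘(ℝ, E)) ∞
    (fun x ↦ (⟨x, X x⟩ : TangentBundle 𝓘(ℝ, E) M))

/-- The vector field `T X`. -/
def EndField.app (T : EndField E M) (X : VField E M) : VField E M := fun x ↦ T x (X x)

/-- The derivative `L_X f` of a function `f` along a vector field `X`. -/
def lieD (X : VField E M) (f : M → ℝ) (x : M) : ℝ := mvfderiv 𝓘(ℝ, E) f x (X x)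

/-- The commutator `[X, Y]` of vector fields. -/
abbrev bracket (X Y : VField E M) : VField E M := VectorField.mlieBracket 𝓘(ℝ, E) X Y

/-- The Nijenhuis tensor `N_T(X, Y) = [TX, TY] + T²[X, Y] - T[TX, Y] - T[X, TY]`. -/
def nijenhuis (T : EndField E M) (X Y : VField E M) : VField E M := fun x ↦
  bracket (T.app X) (T.app Y) x + T x (T x (bracket X Y x))
    - T x (bracket (T.app X) Y x) - T x (bracket X (T.app Y) x)

/-- A field `T` of endomorphisms (with `T² = ± Id`) is integrable: its Nijenhuis tensor vanishes. -/
def EndField.IsIntegrable (T : EndField E M) : Prop :=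
  ∀ X Y : VField E M, IsSmooth X → IsSmooth Y → ∀ x, nijenhuis T X Y x = 0

end Fields

section Structures

variable (E : Type*) [NormedAddCommGroup E] [NormedSpace ℝ E]
  (M : Type*) [TopologicalSpace M] [ChartedSpace E M] [IsManifold 𝓘(ℝ, E) ∞ M]

/-- A smooth non-degenerate bilinear form on the tangent bundle of `M`. -/
structure NondegForm where
  /-- the bilinear form on each tangent space -/
  val : ∀ x : M, TangentSpace 𝓘(ℝ, E) x →L[ℝ] TangentSpace 𝓘(ℝ, E) x →L[ℝ] ℝ
  nondegenerate : ∀ (x : M) (v : TangentSpace 𝓘(ℝ, E) x), (∀ w, val x v w = 0) → v = 0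
  smooth : ContMDiff 𝓘(ℝ, E) (𝓘(ℝ, E).prod 𝓘(ℝ, E →L[ℝ] E →L[ℝ] ℝ)) ∞
    (fun x ↦ TotalSpace.mk' (E →L[ℝ] E →L[ℝ] ℝ)
      (E := fun x : M ↦ TangentSpace 𝓘(ℝ, E) x →L[ℝ] TangentSpace 𝓘(ℝ, E) x →L[ℝ] ℝ) x (val x))

/-- A pseudo-Riemannian metric on `M`, of arbitrary signature. -/
structure PseudoRiemannianMetric extends NondegForm E M where
  symm : ∀ (x : M) (v w : TangentSpace 𝓘(ℝ, E) x), val x v w = val x w v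

/-- A non-degenerate 2-form on `M`. -/
structure NondegTwoForm extends NondegForm E M where
  alt : ∀ (x : M) (v w : TangentSpace 𝓘(ℝ, E) x), val x v w = - val x w v

variable {E M}

/-- The function `b(X, Y)`. -/
def NondegForm.pair (b : NondegForm E M) (X Y : VField E M) (x : M) : ℝ := b.val x (X x) (Y x)

/-- The exterior derivative of a 2-form, evaluated on three vector fields. -/
def NondegTwoForm.extDeriv (om : NondegTwoForm E M) (X Y Z : VField E M) (x : M) : ℝ :=
  lieD X (om.pair Y Z) x - lieD Y (om.pair X Z) x + lieD Z (om.pair X Y) x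
    - om.pair (bracket X Y) Z x + om.pair (bracket X Z) Y x - om.pair (bracket Y Z) X x

/-- `dω = 0`. -/
def NondegTwoForm.IsClosed (om : NondegTwoForm E M) : Prop :=
  ∀ X Y Z : VField E M, IsSmooth X → IsSmooth Y → IsSmooth Z → ∀ x, om.extDeriv X Y Z x = 0

variable [FiniteDimensional ℝ E]

instance (x : M) : FiniteDimensional ℝ (TangentSpace 𝓘(ℝ, E) x) :=
  inferInstanceAs (FiniteDimensional ℝ E)

instance (x : M) : T2Space (TangentSpace 𝓘(ℝ, E) x) :=
  inferInstanceAs (T2Space E)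

/-- A non-degenerate form identifies each tangent space with its dual, `v ↦ b(v, ·)`. -/
def NondegForm.toDual (b : NondegForm E M) (x : M) :
    TangentSpace 𝓘(ℝ, E) x ≃ₗ[ℝ] Module.Dual ℝ (TangentSpace 𝓘(ℝ, E) x) :=
  LinearMap.linearEquivOfInjective
    (ContinuousLinearMap.coeLM ℝ ∘ₗ (b.val x).toLinearMap)
    ((injective_iff_map_eq_zero _).2 fun v hv ↦
      b.nondegenerate x v fun w ↦ LinearMap.congr_fun hv w)
    Subspace.dual_finrank_eq.symm

/-- The recursion operator from `a` to `b`: the field of endomorphisms `A` determined by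
`a(A ·, ·) = b(·, ·)`. -/
def recursionOperator (a b : NondegForm E M) : EndField E M := fun x ↦
  LinearMap.toContinuousLinearMap ((b.toDual x).trans (a.toDual x).symm).toLinearMap

theorem recursionOperator_spec (a b : NondegForm E M) (x : M) (v w : TangentSpace 𝓘(ℝ, E) x) :
    a.val x (recursionOperator a b x v) w = b.val x v w :=
  LinearMap.congr_fun ((a.toDual x).apply_symm_apply (b.toDual x v)) w

theorem recursionOperator_unique (a b : NondegForm E M) (A : EndField E M)
    (hA : ∀ x v w, a.val x (A x v) w = b.val x v w) : A = recursionOperator a b := by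
  funext x
  ext v
  refine sub_eq_zero.1 (a.nondegenerate x _ fun w ↦ ?_)
  rw [map_sub, sub_apply, hA, recursionOperator_spec, sub_self]

variable (E M) in
/-- A Born structure `(g, h, ω)`: the recursion operators `A` from `g` to `ω`, `B` from `g` to `h`
and `-J` from `ω` to `h` satisfy `A² = B² = -J² = Id`. -/
structure BornStructure where
  /-- the pseudo-Riemannian metric `g` -/
  g : PseudoRiemannianMetric E M
  /-- the pseudo-Riemannian metric `h` -/
  h : PseudoRiemannianMetric E M
  /-- the non-degenerate 2-form `ω` -/
  om : NondegTwoForm E M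
  sq_A : ∀ x v, recursionOperator g.toNondegForm om.toNondegForm x
    (recursionOperator g.toNondegForm om.toNondegForm x v) = v
  sq_B : ∀ x v, recursionOperator g.toNondegForm h.toNondegForm x
    (recursionOperator g.toNondegForm h.toNondegForm x v) = v
  sq_J : ∀ x v, (-recursionOperator om.toNondegForm h.toNondegForm x)
    ((-recursionOperator om.toNondegForm h.toNondegForm x) v) = -v

namespace BornStructure

variable (S : BornStructure E M)

/-- The recursion operator `A` from `g` to `ω`. -/
def A : EndField E M := recursionOperator S.g.toNondegForm S.om.toNondegForm

/-- The recursion operator `B` from `g` to `h`. -/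
def B : EndField E M := recursionOperator S.g.toNondegForm S.h.toNondegForm

/-- The endomorphism field `J`, such that `-J` is the recursion operator from `ω` to `h`. -/
def J : EndField E M := fun x ↦ -recursionOperator S.om.toNondegForm S.h.toNondegForm x

/-- A Born structure is integrable if `ω` is closed and at least two of the recursion operators
`A`, `B`, `J` are integrable. -/
def IsIntegrable : Prop :=
  S.om.IsClosed ∧
    ((S.A.IsIntegrable ∧ S.B.IsIntegrable) ∨ (S.A.IsIntegrable ∧ S.J.IsIntegrable) ∨
      (S.B.IsIntegrable ∧ S.J.IsIntegrable))

/-- The `(+1)`-eigenbundle `L₊` of `A`. -/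
def Lplus (x : M) : Submodule ℝ (TangentSpace 𝓘(ℝ, E) x) :=
  Module.End.eigenspace (S.A x).toLinearMap 1

/-- The `(-1)`-eigenbundle `L₋` of `A`. -/
def Lminus (x : M) : Submodule ℝ (TangentSpace 𝓘(ℝ, E) x) :=
  Module.End.eigenspace (S.A x).toLinearMap (-1)

end BornStructure

end Structures

/-! ## Affine connections -/

section Connections

variable (E : Type*) [NormedAddCommGroup E] [NormedSpace ℝ E]
  (M : Type*) [TopologicalSpace M] [ChartedSpace E M] [IsManifold 𝓘(ℝ, E) ∞ M]

/-- A smooth affine connection on `M`: a covariant derivative on the tangent bundle such that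
`∇_X Y` is a smooth vector field whenever `X` and `Y` are. -/
structure AffineConnection
    extends CovariantDerivative 𝓘(ℝ, E) E (TangentSpace 𝓘(ℝ, E) : M → Type _) where
  smooth : ∀ X Y : VField E M, IsSmooth X → IsSmooth Y → IsSmooth (fun x ↦ toFun Y x (X x))

variable {E M}

namespace AffineConnection

/-- The vector field `∇_X Y`. -/
def cov (D : AffineConnection E M) (X Y : VField E M) : VField E M := fun x ↦ D.toFun Y x (X x)

/-- Two connections are equal as maps `𝔛(M) × 𝔛(M) → 𝔛(M)`. (The values of a
`CovariantDerivative` on non-differentiable sections carry no meaning and are disregarded.) -/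
def Agree (D D' : AffineConnection E M) : Prop :=
  ∀ X Y : VField E M, IsSmooth X → IsSmooth Y → D.cov X Y = D'.cov X Y

/-- The form `b` is parallel: `L_X (b(Y, Z)) = b(∇_X Y, Z) + b(Y, ∇_X Z)`. -/
def IsParallel (D : AffineConnection E M) (b : NondegForm E M) : Prop :=
  ∀ X Y Z : VField E M, IsSmooth X → IsSmooth Y → IsSmooth Z →
    ∀ x, lieD X (b.pair Y Z) x = b.pair (D.cov X Y) Z x + b.pair Y (D.cov X Z) x

/-- The connection preserves the subbundle `F`. -/
def Preserves (D : AffineConnection E M)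
    (F : ∀ x : M, Submodule ℝ (TangentSpace 𝓘(ℝ, E) x)) : Prop :=
  ∀ X Y : VField E M, IsSmooth X → IsSmooth Y → (∀ x, Y x ∈ F x) → ∀ x, D.cov X Y x ∈ F x

/-- The average `½ (∇_X Y + T ∇_X (T Y))` of `∇` under conjugation with an involution `T`. -/
def average (D : AffineConnection E M) (T : EndField E M) (X Y : VField E M) : VField E M :=
  fun x ↦ (1 / 2 : ℝ) • (D.cov X Y x + T x (D.cov X (T.app Y) x))

/-- There is one and only one affine connection with the property `P`. -/
def ExistsUnique (P : AffineConnection E M → Prop) : Prop :=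
  ∃ D, P D ∧ ∀ D', P D' → D'.Agree D

variable [FiniteDimensional ℝ E]

/-- `∇` is the Levi-Civita connection of the pseudo-Riemannian metric `g`. -/
def IsLeviCivita (g : PseudoRiemannianMetric E M) (D : AffineConnection E M) : Prop :=
  D.IsParallel g.toNondegForm ∧ D.torsion = 0

/-- `∇` is the Künneth connection of the almost Künneth structure `(ω, F, G)`: it preserves `F` and
`G`, is compatible with `ω`, and its mixed torsion vanishes. -/
def IsKunneth (om : NondegTwoForm E M) (F G : ∀ x : M, Submodule ℝ (TangentSpace 𝓘(ℝ, E) x))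
    (D : AffineConnection E M) : Prop :=
  D.Preserves F ∧ D.Preserves G ∧ D.IsParallel om.toNondegForm ∧
    ∀ x, ∀ u ∈ F x, ∀ v ∈ G x, D.torsion x u v = 0 ∧ D.torsion x v u = 0

end AffineConnection

namespace BornStructure

variable [FiniteDimensional ℝ E] (S : BornStructure E M)

/-- `∇` is the Künneth connection of the underlying almost Künneth structure `(ω, L₊, L₋)`. -/
def IsKunnethConnection (D : AffineConnection E M) : Prop :=
  AffineConnection.IsKunneth S.om S.Lplus S.Lminus D

/-- `∇` is compatible with the Born structure: `∇g = ∇h = ∇ω = 0`. -/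
def IsCompatible (D : AffineConnection E M) : Prop :=
  D.IsParallel S.g.toNondegForm ∧ D.IsParallel S.h.toNondegForm ∧ D.IsParallel S.om.toNondegForm

/-- `∇` has vanishing generalized torsion:
`g(∇_X Y - ∇_Y X, Z) + g(∇_Z X, Y) = g(∇ᶜ_X Y - ∇ᶜ_Y X, Z) + g(∇ᶜ_Z X, Y)`,
where `∇ᶜ_X Y = ½ (∇ᵍ_X Y + A ∇ᵍ_X (A Y))` is the canonical connection, `∇ᵍ` being the
Levi-Civita connection of `g`. -/
def HasVanishingGenTorsion (D : AffineConnection E M) : Prop :=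
  ∀ Dg : AffineConnection E M, AffineConnection.IsLeviCivita S.g Dg →
    ∀ X Y Z : VField E M, IsSmooth X → IsSmooth Y → IsSmooth Z → ∀ x,
      S.g.val x (D.cov X Y x - D.cov Y X x) (Z x) + S.g.val x (D.cov Z X x) (Y x) =
        S.g.val x (Dg.average S.A X Y x - Dg.average S.A Y X x) (Z x)
          + S.g.val x (Dg.average S.A Z X x) (Y x)

/-- `∇` is the Born connection: it is compatible with the Born structure and has vanishing
generalized torsion. -/
def IsBornConnection (D : AffineConnection E M) : Prop :=
  S.IsCompatible D ∧ S.HasVanishingGenTorsion D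

end BornStructure

end Connections

end BornGeometry

end

/-! The algebra of a Born structure gives `J = -AB` and `AB = -BA`, with `A` skew and `B`
self-adjoint for `g`. Hence both eigenbundles of `A` are `g`-isotropic, paired nondegenerately by
`g`, and interchanged by `B`. If `B` and `J` are integrable then so is `A`, so in every case `A` is
integrable together with `B` or `J`.

Existence of `∇ᵍ` is the Koszul formula. When `A` is integrable and `ω` is closed, `∇ᵍ` preserves
both eigenbundles (`cov_eigen`). It therefore commutes with `A` and preserves `ω = g(A·,·)`; being
torsion-free, it is the Künneth connection, and it is also its own canonical connection.

The average of `∇ᵍ` under `B` preserves `g`, commutes with `B`, and still commutes with `A`, so it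
preserves the Born structure. Splitting the Nijenhuis tensor of `B` or `J` along the eigenbundles
shows that averaging leaves the torsion on each eigenbundle unchanged (`averageB_torsion_eigen`).
For connections preserving `g` and `A`, this determines the generalized torsion (`genTorsion_eq`),
so the average is a Born connection.

Two Born connections differ by a tensor `δ`. On one eigenbundle, `h(δ_X Y, W)` is symmetric in `X,
Y` and skew in `Y, W`, hence zero; `B` carries this to the mixed case. Finally `-J∇J = B∇B` for any
`∇` commuting with `A`, which gives the second formula. -/

noncomputable section

namespace BornGeometry

open Filter Topology

/-! ### Smoothness of determinants and inverse matrices. -/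

section Matrix

variable {E : Type*} [NormedAddCommGroup E] [NormedSpace ℝ E]
  {M : Type*} [TopologicalSpace M] [ChartedSpace E M]

theorem contMDiffAt_det {n : Type*} [Fintype n] [DecidableEq n] {G : M → Matrix n n ℝ} {x : M}
    (hG : ∀ i j, CMDiffAt ∞ (fun y ↦ G y i j) x) : CMDiffAt ∞ (fun y ↦ (G y).det) x := by
  simp only [Matrix.det_apply]
  refine contMDiffAt_finsetSum fun σ _ ↦ ?_
  simp only [Units.smul_def, zsmul_eq_mul]
  exact contMDiffAt_const.mul (contMDiffAt_finsetProd fun i _ ↦ hG _ _)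

theorem contMDiffAt_matrix_inv {n : Type*} [Fintype n] [DecidableEq n] {G : M → Matrix n n ℝ}
    {x : M} (hG : ∀ i j, CMDiffAt ∞ (fun y ↦ G y i j) x) (hx : (G x).det ≠ 0) (i j : n) :
    CMDiffAt ∞ (fun y ↦ (G y)⁻¹ i j) x := by
  simp only [Matrix.inv_def, Ring.inverse_eq_inv', Matrix.smul_apply, smul_eq_mul]
  refine ((contMDiffAt_det hG).inv₀ hx).mul ?_
  -- Cramer's rule: an adjugate entry is the determinant with one row replaced by a constant vector.
  simp only [Matrix.adjugate_apply]
  refine contMDiffAt_det fun k l ↦ ?_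
  by_cases hk : k = j
  · subst hk
    simpa using! contMDiffAt_const
  · simpa [Matrix.updateRow_ne hk] using hG k l

end Matrix

/-! ### Smooth vector fields: extensions, and detection by a nondegenerate form. -/

section Fields

variable {E : Type*} [NormedAddCommGroup E] [NormedSpace ℝ E]
  {M : Type*} [TopologicalSpace M] [ChartedSpace E M] [IsManifold 𝓘(ℝ, E) ∞ M]

theorem IsSmooth.mdiffAt {X : VField E M} (hX : IsSmooth X) (x : M) : MDiffAt (T% X) x :=
  (hX x).mdifferentiableAt (by simp)

theorem IsSmooth.add {X Y : VField E M} (hX : IsSmooth X) (hY : IsSmooth Y) : IsSmooth (X + Y) :=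
  ContMDiff.add_section hX hY

theorem IsSmooth.neg {X : VField E M} (hX : IsSmooth X) : IsSmooth (-X) :=
  ContMDiff.neg_section hX

theorem IsSmooth.const_smul {X : VField E M} (a : ℝ) (hX : IsSmooth X) : IsSmooth (a • X) :=
  ContMDiff.const_smul_section hX

theorem IsSmooth.bracket [FiniteDimensional ℝ E] {X Y : VField E M} (hX : IsSmooth X)
    (hY : IsSmooth Y) : IsSmooth (bracket X Y) := by
  have : CompleteSpace E := FiniteDimensional.complete ℝ E
  have : IsManifold 𝓘(ℝ, E) (minSmoothness ℝ 2) M := by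
    rw [minSmoothness_of_isRCLikeNormedField]
    infer_instance
  have : IsManifold 𝓘(ℝ, E) (((⊤ : ℕ∞) : ℕ∞ω) + 1) M := by
    change IsManifold 𝓘(ℝ, E) ∞ M
    infer_instance
  exact ContDiff.mlieBracket_vectorField (m := ⊤) (n := ⊤) hX hY (by simp)

theorem lieD_contMDiff {X : VField E M} {f : M → ℝ} (hX : IsSmooth X) (hf : CMDiff ∞ f) :
    CMDiff ∞ (lieD X f) := by
  have h1 : CMDiff ∞ (tangentMap 𝓘(ℝ, E) 𝓘(ℝ) f) := hf.contMDiff_tangentMap (by rfl)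
  exact (contMDiff_snd_tangentBundle_modelSpace ℝ 𝓘(ℝ)).comp (h1.comp hX)

/-- A local frame is cut off by a bump function equal to one near `x`. Global fields are needed
because all the defining conditions quantify over global smooth fields. -/
theorem exists_smooth_frame [T2Space M] [FiniteDimensional ℝ E]
    (e : Trivialization E (TotalSpace.proj : TangentBundle 𝓘(ℝ, E) M → M))
    [MemTrivializationAtlas e] {x : M} (hxe : x ∈ e.baseSet) :
    ∃ s : Fin (Module.finrank ℝ E) → VField E M, (∀ i, IsSmooth (s i)) ∧
      ∀ᶠ y in 𝓝 x, ∀ i, s i y = e.localFrame (Module.finBasis ℝ E) i y := by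
  have hx : e.baseSet ∈ 𝓝 x := e.open_baseSet.mem_nhds hxe
  obtain ⟨f, hf, -⟩ := (SmoothBumpFunction.nhds_basis_support (I := 𝓘(ℝ, E)) hx).mem_iff.1 hx
  refine ⟨fun i ↦ (f : M → ℝ) • e.localFrame (Module.finBasis ℝ E) i, fun i ↦ ?_, ?_⟩
  · exact ContMDiffOn.smul_section_of_tsupport f.contMDiff.contMDiffOn e.open_baseSet hf
      (e.contMDiffOn_localFrame_baseSet _ _ i)
  · filter_upwards [f.eventuallyEq_one] with y hy i
    simp [hy]

theorem exists_smooth_extension [T2Space M] [FiniteDimensional ℝ E] (x : M)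
    (v : TangentSpace 𝓘(ℝ, E) x) : ∃ X : VField E M, IsSmooth X ∧ X x = v := by
  let e := trivializationAt E (TangentSpace 𝓘(ℝ, E)) x
  have hx : x ∈ e.baseSet := mem_baseSet_trivializationAt _ _ x
  obtain ⟨s, hs, hse⟩ := exists_smooth_frame e hx
  refine ⟨fun y ↦ ∑ i, ((e.basisAt (Module.finBasis ℝ E) hx).repr v i • s i) y, ?_, ?_⟩
  · exact ContMDiff.sum_section fun i _ ↦ (hs i).const_smul _
  · simp [hse.self_of_nhds, hx, Module.Basis.sum_repr]

theorem NondegForm.pair_mdiffAt (b : NondegForm E M) {X Y : VField E M} {x : M}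
    (hX : MDiffAt (T% X) x) (hY : MDiffAt (T% Y) x) : MDiffAt (b.pair X Y) x := by
  have := MDifferentiableAt.clm_bundle_apply₂ (E₃ := fun _ : M ↦ ℝ)
    ((b.smooth x).mdifferentiableAt (by simp)) hX hY
  exact ((mdifferentiableAt_totalSpace _ _).1 this).2

theorem NondegForm.pair_contMDiff (b : NondegForm E M) {X Y : VField E M}
    (hX : IsSmooth X) (hY : IsSmooth Y) : CMDiff ∞ (b.pair X Y) := by
  intro x
  have := ContMDiffAt.clm_bundle_apply₂ (E₃ := fun _ : M ↦ ℝ) (b.smooth x) (hX x) (hY x)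
  exact (contMDiffAt_totalSpace.1 this).2

/-- A vector field is smooth if its pairings with all smooth vector fields are. -/
theorem NondegForm.isSmooth_of_pair [T2Space M] [FiniteDimensional ℝ E] (b : NondegForm E M)
    {V : VField E M} (hV : ∀ W : VField E M, IsSmooth W → CMDiff ∞ (b.pair V W)) :
    IsSmooth V := by
  intro x
  let e := trivializationAt E (TangentSpace 𝓘(ℝ, E)) x
  let β := Module.finBasis ℝ E
  have hx : x ∈ e.baseSet := mem_baseSet_trivializationAt _ _ x
  obtain ⟨s, hs, hse⟩ := exists_smooth_frame e hx
  -- The Gram matrix of the frame: its inverse recovers the coefficients of `V` from the pairings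
  -- `b(V, s_j)`.
  let G : M → Matrix _ _ ℝ := fun y ↦ Matrix.of fun i j ↦ b.pair (s i) (s j) y
  have hG : ∀ i j, CMDiffAt ∞ (fun y ↦ G y i j) x := fun i j ↦ b.pair_contMDiff (hs i) (hs j) x
  have hdet : ∀ᶠ y in 𝓝 x, (G y).det ≠ 0 := by
    refine (contMDiffAt_det hG).continuousAt.eventually_ne ?_
    -- A null vector of the Gram matrix at `x` would be a tangent vector annihilated by `b`.
    rw [Ne, ← Matrix.exists_vecMul_eq_zero_iff]
    rintro ⟨c, hc, h0⟩
    have hli := (e.basisAt β hx).linearIndependent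
    have hz : ∑ i, c i • e.basisAt β hx i = 0 := by
      refine b.nondegenerate x _ fun w ↦ ?_
      rw [← (e.basisAt β hx).sum_repr w, map_sum]
      refine Finset.sum_eq_zero fun j _ ↦ ?_
      have := congr_fun h0 j
      simp only [Matrix.vecMul, dotProduct, G, Matrix.of_apply, NondegForm.pair,
        hse.self_of_nhds, Pi.zero_apply] at this
      simp only [e.localFrame_apply_of_mem_baseSet (Module.finBasis ℝ E) hx] at this
      rw [map_smul, map_sum, sum_apply]
      simp only [map_smul, smul_apply, smul_eq_mul, mul_eq_zero]
      exact Or.inr this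
    exact hc (funext (Fintype.linearIndependent_iff.1 hli c hz))
  rw [contMDiffAt_iff_localFrameCoeff β hx]
  intro i
  have key : CMDiffAt ∞ (fun y ↦ ∑ j, b.pair V (s j) y * (G y)⁻¹ j i) x :=
    contMDiffAt_finsetSum fun j _ ↦
      (hV _ (hs j) x).mul (contMDiffAt_matrix_inv hG hdet.self_of_nhds j i)
  refine key.congr_of_eventuallyEq ?_
  filter_upwards [hse, hdet, e.open_baseSet.mem_nhds hx] with y hy hd hye
  let c : Fin (Module.finrank ℝ E) → ℝ := fun i ↦ e.localFrameCoeff 𝓘(ℝ, E) β i y (V y)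
  have hc : Matrix.vecMul c (G y) = fun j ↦ b.pair V (s j) y := by
    funext j
    have hVy : V y = ∑ i, c i • s i y := by
      simp only [hy]
      exact e.eq_sum_localFrameCoeff_smul hye
    simp [Matrix.vecMul, dotProduct, G, NondegForm.pair, hVy, sum_apply]
  have := congr_fun (congr_arg (fun p ↦ Matrix.vecMul p (G y)⁻¹) hc) i
  simp only [Matrix.vecMul_vecMul, Matrix.mul_nonsing_inv _ (isUnit_iff_ne_zero.2 hd),
    Matrix.vecMul_one] at this
  simpa [Matrix.vecMul, dotProduct] using! this

theorem NondegForm.ext_smooth [T2Space M] [FiniteDimensional ℝ E] (b : NondegForm E M) {x : M}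
    {v w : TangentSpace 𝓘(ℝ, E) x}
    (h : ∀ Z : VField E M, IsSmooth Z → b.val x v (Z x) = b.val x w (Z x)) : v = w := by
  refine sub_eq_zero.1 (b.nondegenerate x _ fun u ↦ ?_)
  obtain ⟨Z, hZ, rfl⟩ := exists_smooth_extension x u
  rw [map_sub, sub_apply, h Z hZ, sub_self]

/-- A field of endomorphisms that preserves smooth vector fields. -/
def EndField.PreservesSmooth (T : EndField E M) : Prop :=
  ∀ X : VField E M, IsSmooth X → IsSmooth (T.app X)

/-- The axioms of a covariant derivative concern fields differentiable at a single point, so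
conjugating a connection by `T` needs this pointwise form. Near `x`, expand `X` in a smooth frame;
`T` acts only on the frame, where the result is smooth. -/
theorem EndField.PreservesSmooth.mdiffAt [T2Space M] [FiniteDimensional ℝ E] {T : EndField E M}
    (hT : T.PreservesSmooth) {X : VField E M} {x : M} (hX : MDiffAt (T% X) x) :
    MDiffAt (T% (T.app X)) x := by
  let e := trivializationAt E (TangentSpace 𝓘(ℝ, E)) x
  let β := Module.finBasis ℝ E
  have hx : x ∈ e.baseSet := mem_baseSet_trivializationAt _ _ x
  obtain ⟨s, hs, hse⟩ := exists_smooth_frame e hx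
  have hc := mdifferentiableAt_localFrameCoeff β hx hX
  have key : MDiffAt (T% (fun y ↦ ∑ i,
      ((LinearMap.piApply (e.localFrameCoeff 𝓘(ℝ, E) β i) X) • T.app (s i)) y)) x :=
    MDifferentiableAt.sum_section fun i _ ↦ (hc i).smul_section ((hT _ (hs i)).mdiffAt x)
  refine key.congr_of_eventuallyEq ?_
  filter_upwards [hse, e.open_baseSet.mem_nhds hx] with y hy hye
  have hVy : X y = ∑ i, e.localFrameCoeff 𝓘(ℝ, E) β i y (X y) • s i y := by
    simp only [hy]
    exact e.eq_sum_localFrameCoeff_smul hye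
  simp only [EndField.app, TotalSpace.mk_inj]
  conv_lhs => rw [hVy]
  simp [EndField.app]

end Fields

/-! ### Calculus of Lie derivatives and pairings. -/

section Calculus

variable {E : Type*} [NormedAddCommGroup E] [NormedSpace ℝ E]
  {M : Type*} [TopologicalSpace M] [ChartedSpace E M]

theorem lieD_add {X : VField E M} {f f' : M → ℝ} {x : M} (hf : MDiffAt f x) (hf' : MDiffAt f' x) :
    lieD X (f + f') x = lieD X f x + lieD X f' x := by
  simp [lieD, mvfderiv_add hf hf']

theorem lieD_mul {X : VField E M} {f f' : M → ℝ} {x : M} (hf : MDiffAt f x) (hf' : MDiffAt f' x) :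
    lieD X (f * f') x = f x * lieD X f' x + f' x * lieD X f x := by
  simp [lieD, mvfderiv_mul hf hf']

theorem lieD_zero {X : VField E M} {x : M} : lieD X (0 : M → ℝ) x = 0 := by
  simp [lieD, mvfderiv_zero]

theorem lieD_add_left (X X' : VField E M) (f : M → ℝ) (x : M) :
    lieD (X + X') f x = lieD X f x + lieD X' f x := by
  simp [lieD]

theorem lieD_smul_left (a : M → ℝ) (X : VField E M) (f : M → ℝ) (x : M) :
    lieD (a • X) f x = a x * lieD X f x := by
  simp [lieD]

theorem bracket_swap (X Y : VField E M) (x : M) : bracket X Y x = -bracket Y X x :=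
  VectorField.mlieBracket_swap_apply

variable [IsManifold 𝓘(ℝ, E) ∞ M]

namespace NondegForm

variable (b : NondegForm E M)

theorem pair_add_left (X X' Y : VField E M) : b.pair (X + X') Y = b.pair X Y + b.pair X' Y := by
  ext x; simp [pair]

theorem pair_add_right (X Y Y' : VField E M) : b.pair X (Y + Y') = b.pair X Y + b.pair X Y' := by
  ext x; simp [pair]

theorem pair_smul_left (f : M → ℝ) (X Y : VField E M) : b.pair (f • X) Y = f * b.pair X Y := by
  ext x; simp [pair]

theorem pair_smul_right (f : M → ℝ) (X Y : VField E M) : b.pair X (f • Y) = f * b.pair X Y := by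
  ext x; simp [pair]

end NondegForm

theorem PseudoRiemannianMetric.pair_comm (g : PseudoRiemannianMetric E M) (X Y : VField E M) :
    g.pair X Y = g.pair Y X :=
  funext fun x ↦ g.symm x _ _

end Calculus

/-! ### The Levi-Civita connection via the Koszul formula. -/

section LeviCivita

variable {E : Type*} [NormedAddCommGroup E] [NormedSpace ℝ E] [FiniteDimensional ℝ E]
  {M : Type*} [TopologicalSpace M] [ChartedSpace E M] [IsManifold 𝓘(ℝ, E) ∞ M]

theorem bracket_add_left {X X' Y : VField E M} {x : M} (hX : MDiffAt (T% X) x)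
    (hX' : MDiffAt (T% X') x) : bracket (X + X') Y x = bracket X Y x + bracket X' Y x :=
  VectorField.mlieBracket_add_left hX hX'

theorem bracket_add_right {X Y Y' : VField E M} {x : M} (hY : MDiffAt (T% Y) x)
    (hY' : MDiffAt (T% Y') x) : bracket X (Y + Y') x = bracket X Y x + bracket X Y' x :=
  VectorField.mlieBracket_add_right hY hY'

theorem bracket_smul_right {X Y : VField E M} {f : M → ℝ} {x : M} (hf : MDiffAt f x)
    (hY : MDiffAt (T% Y) x) : bracket X (f • Y) x = lieD X f x • Y x + f x • bracket X Y x := by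
  have : CompleteSpace E := FiniteDimensional.complete ℝ E
  exact VectorField.mlieBracket_smul_right hf hY

theorem bracket_smul_left {X Y : VField E M} {f : M → ℝ} {x : M} (hf : MDiffAt f x)
    (hX : MDiffAt (T% X) x) : bracket (f • X) Y x = -lieD Y f x • X x + f x • bracket X Y x := by
  have : CompleteSpace E := FiniteDimensional.complete ℝ E
  exact VectorField.mlieBracket_smul_left hf hX

namespace PseudoRiemannianMetric

variable (g : PseudoRiemannianMetric E M)

/-- The right-hand side of the Koszul formula for `2 g(∇_X Y, Z)`. -/
def koszul (X Y Z : VField E M) (x : M) : ℝ :=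
  lieD X (g.pair Y Z) x + lieD Y (g.pair X Z) x - lieD Z (g.pair X Y) x
    + g.val x (bracket X Y x) (Z x) - g.val x (bracket X Z x) (Y x)
    - g.val x (bracket Y Z x) (X x)

variable {g} {X X' Y Y' Z Z' : VField E M} {f : M → ℝ} {x : M}

theorem koszul_add_left (hX : MDiffAt (T% X) x) (hX' : MDiffAt (T% X') x) (hY : MDiffAt (T% Y) x)
    (hZ : MDiffAt (T% Z) x) : g.koszul (X + X') Y Z x = g.koszul X Y Z x + g.koszul X' Y Z x := by
  simp only [koszul, lieD_add_left, NondegForm.pair_add_left,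
    lieD_add (g.pair_mdiffAt hX hZ) (g.pair_mdiffAt hX' hZ),
    lieD_add (g.pair_mdiffAt hX hY) (g.pair_mdiffAt hX' hY),
    bracket_add_left hX hX', map_add, add_apply, Pi.add_apply]
  ring

theorem koszul_smul_left (hf : MDiffAt f x) (hX : MDiffAt (T% X) x) (hY : MDiffAt (T% Y) x)
    (hZ : MDiffAt (T% Z) x) : g.koszul (f • X) Y Z x = f x * g.koszul X Y Z x := by
  simp only [koszul, lieD_smul_left, NondegForm.pair_smul_left,
    lieD_mul hf (g.pair_mdiffAt hX hZ), lieD_mul hf (g.pair_mdiffAt hX hY),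
    bracket_smul_left hf hX, map_add, add_apply, map_smul, smul_apply, smul_eq_mul,
    Pi.smul_apply', NondegForm.pair]
  ring

theorem koszul_add_middle (hX : MDiffAt (T% X) x) (hY : MDiffAt (T% Y) x)
    (hY' : MDiffAt (T% Y') x) (hZ : MDiffAt (T% Z) x) :
    g.koszul X (Y + Y') Z x = g.koszul X Y Z x + g.koszul X Y' Z x := by
  simp only [koszul, lieD_add_left, NondegForm.pair_add_left, NondegForm.pair_add_right,
    lieD_add (g.pair_mdiffAt hY hZ) (g.pair_mdiffAt hY' hZ),
    lieD_add (g.pair_mdiffAt hX hY) (g.pair_mdiffAt hX hY'),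
    bracket_add_left hY hY', bracket_add_right hY hY', map_add, add_apply, Pi.add_apply]
  ring

/-- The derivatives of `f` along `Y` and `Z` cancel; the surviving term is twice the Leibniz term.
-/
theorem koszul_smul_middle (hf : MDiffAt f x) (hX : MDiffAt (T% X) x) (hY : MDiffAt (T% Y) x)
    (hZ : MDiffAt (T% Z) x) :
    g.koszul X (f • Y) Z x = f x * g.koszul X Y Z x + 2 * lieD X f x * g.val x (Y x) (Z x) := by
  simp only [koszul, lieD_smul_left, NondegForm.pair_smul_left, NondegForm.pair_smul_right,
    lieD_mul hf (g.pair_mdiffAt hY hZ), lieD_mul hf (g.pair_mdiffAt hX hY),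
    bracket_smul_left hf hY, bracket_smul_right hf hY, map_add, add_apply, map_smul, smul_apply,
    smul_eq_mul, Pi.smul_apply', NondegForm.pair, g.symm x (Y x) (X x)]
  ring

theorem koszul_add_right (hX : MDiffAt (T% X) x) (hY : MDiffAt (T% Y) x)
    (hZ : MDiffAt (T% Z) x) (hZ' : MDiffAt (T% Z') x) :
    g.koszul X Y (Z + Z') x = g.koszul X Y Z x + g.koszul X Y Z' x := by
  simp only [koszul, lieD_add_left, NondegForm.pair_add_right,
    lieD_add (g.pair_mdiffAt hY hZ) (g.pair_mdiffAt hY hZ'),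
    lieD_add (g.pair_mdiffAt hX hZ) (g.pair_mdiffAt hX hZ'),
    bracket_add_right hZ hZ', map_add, add_apply, Pi.add_apply]
  ring

theorem koszul_smul_right (hf : MDiffAt f x) (hX : MDiffAt (T% X) x) (hY : MDiffAt (T% Y) x)
    (hZ : MDiffAt (T% Z) x) : g.koszul X Y (f • Z) x = f x * g.koszul X Y Z x := by
  simp only [koszul, lieD_smul_left, NondegForm.pair_smul_right,
    lieD_mul hf (g.pair_mdiffAt hY hZ), lieD_mul hf (g.pair_mdiffAt hX hZ),
    bracket_smul_right hf hZ, map_add, add_apply, map_smul, smul_apply, smul_eq_mul,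
    Pi.smul_apply', NondegForm.pair, g.symm x (Z x) (X x), g.symm x (Z x) (Y x)]
  ring

omit [FiniteDimensional ℝ E] in
-- This identity is what makes the connection torsion-free.
theorem koszul_sub_swap (X Y Z : VField E M) (x : M) :
    g.koszul X Y Z x - g.koszul Y X Z x = 2 * g.val x (bracket X Y x) (Z x) := by
  simp only [koszul, g.pair_comm Y X, bracket_swap Y X x, map_neg, neg_apply]
  ring

omit [FiniteDimensional ℝ E] in
-- This identity is what makes the connection metric.
theorem koszul_add_swap (X Y Z : VField E M) (x : M) :
    g.koszul X Y Z x + g.koszul X Z Y x = 2 * lieD X (g.pair Y Z) x := by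
  simp only [koszul, g.pair_comm Z Y, bracket_swap Z Y x, map_neg, neg_apply]
  ring

theorem koszul_contMDiff (hX : IsSmooth X) (hY : IsSmooth Y) (hZ : IsSmooth Z) :
    CMDiff ∞ (g.koszul X Y Z) := by
  have h1 := lieD_contMDiff hX (g.pair_contMDiff hY hZ)
  have h2 := lieD_contMDiff hY (g.pair_contMDiff hX hZ)
  have h3 := lieD_contMDiff hZ (g.pair_contMDiff hX hY)
  have h4 := g.pair_contMDiff (hX.bracket hY) hZ
  have h5 := g.pair_contMDiff (hX.bracket hZ) hY
  have h6 := g.pair_contMDiff (hY.bracket hZ) hX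
  exact ((((h1.add h2).sub h3).add h4).sub h5).sub h6

theorem koszul_tensorialAt_left (hY : MDiffAt (T% Y) x) (Z : VField E M)
    (hZ : MDiffAt (T% Z) x) : TensorialAt 𝓘(ℝ, E) E (fun X : VField E M ↦ g.koszul X Y Z x) x where
  smul hf hX := koszul_smul_left hf hX hY hZ
  add hX hX' := koszul_add_left hX hX' hY hZ

theorem koszul_tensorialAt_right (hY : MDiffAt (T% Y) x) (X : VField E M)
    (hX : MDiffAt (T% X) x) : TensorialAt 𝓘(ℝ, E) E (fun Z : VField E M ↦ g.koszul X Y Z x) x where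
  smul hf hZ := koszul_smul_right hf hX hY hZ
  add hZ hZ' := koszul_add_right hX hY hZ hZ'

/-- The Koszul expression as a bilinear form in its tensorial arguments. -/
def koszulForm (g : PseudoRiemannianMetric E M) (Y : VField E M) (x : M)
    (hY : MDiffAt (T% Y) x) :
    TangentSpace 𝓘(ℝ, E) x →L[ℝ] TangentSpace 𝓘(ℝ, E) x →L[ℝ] ℝ :=
  TensorialAt.mkHom₂ (fun X Z : VField E M ↦ g.koszul X Y Z x) x
    (fun Z hZ ↦ koszul_tensorialAt_left hY Z hZ) (fun X hX ↦ koszul_tensorialAt_right hY X hX)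

theorem koszulForm_apply (hX : MDiffAt (T% X) x) (hY : MDiffAt (T% Y) x) (hZ : MDiffAt (T% Z) x) :
    koszulForm g Y x hY (X x) (Z x) = g.koszul X Y Z x :=
  TensorialAt.mkHom₂_apply _ _ hX hZ

open scoped Classical in
/-- The Levi-Civita derivative of a rough vector field, set to zero where the field is not
differentiable. -/
def leviCivitaFun (g : PseudoRiemannianMetric E M) (Y : VField E M) (x : M) :
    TangentSpace 𝓘(ℝ, E) x →L[ℝ] TangentSpace 𝓘(ℝ, E) x :=
  if hY : MDiffAt (T% Y) x then
    LinearMap.toContinuousLinearMap ((1 / 2 : ℝ) • ((g.toDual x).symm.toLinearMap ∘ₗ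
      ContinuousLinearMap.coeLM ℝ ∘ₗ (koszulForm g Y x hY).toLinearMap))
  else 0

theorem leviCivitaFun_spec (hX : MDiffAt (T% X) x) (hY : MDiffAt (T% Y) x)
    (hZ : MDiffAt (T% Z) x) :
    2 * g.val x (leviCivitaFun g Y x (X x)) (Z x) = g.koszul X Y Z x := by
  rw [← koszulForm_apply hX hY hZ, leviCivitaFun, dif_pos hY]
  have := LinearMap.congr_fun ((g.toDual x).apply_symm_apply
    (ContinuousLinearMap.coeLM ℝ (koszulForm g Y x hY (X x)))) (Z x)
  change g.val x ((g.toDual x).symm _) (Z x) = koszulForm g Y x hY (X x) (Z x) at this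
  rw [← this]
  simp

theorem leviCivitaFun_smooth [T2Space M] (hX : IsSmooth X) (hY : IsSmooth Y) :
    IsSmooth (fun x ↦ leviCivitaFun g Y x (X x)) := by
  refine g.isSmooth_of_pair fun Z hZ ↦ ?_
  have h : g.pair (fun x ↦ leviCivitaFun g Y x (X x)) Z = fun x ↦ 1 / 2 * g.koszul X Y Z x := by
    funext x
    rw [← leviCivitaFun_spec (hX.mdiffAt x) (hY.mdiffAt x) (hZ.mdiffAt x), NondegForm.pair]
    ring
  rw [h]
  exact contMDiff_const.mul (koszul_contMDiff hX hY hZ)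

/-- The Levi-Civita connection of a pseudo-Riemannian metric. -/
def leviCivita [T2Space M] (g : PseudoRiemannianMetric E M) : AffineConnection E M where
  toFun := leviCivitaFun g
  isCovariantDerivativeOnUniv :=
    { add := by
        intro Y Y' x hY hY' _
        ext v
        obtain ⟨X, hX, rfl⟩ := exists_smooth_extension x v
        refine g.ext_smooth fun Z hZ ↦ ?_
        have h1 := leviCivitaFun_spec (g := g) (hX.mdiffAt x) (mdifferentiableAt_add_section hY hY')
          (hZ.mdiffAt x)
        have h2 := leviCivitaFun_spec (g := g) (hX.mdiffAt x) hY (hZ.mdiffAt x)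
        have h3 := leviCivitaFun_spec (g := g) (hX.mdiffAt x) hY' (hZ.mdiffAt x)
        rw [koszul_add_middle (hX.mdiffAt x) hY hY' (hZ.mdiffAt x)] at h1
        rw [add_apply, map_add, add_apply]
        linarith
      leibniz := by
        intro Y f x hY hf _
        ext v
        obtain ⟨X, hX, rfl⟩ := exists_smooth_extension x v
        refine g.ext_smooth fun Z hZ ↦ ?_
        have h1 := leviCivitaFun_spec (g := g) (hX.mdiffAt x) (hf.smul_section hY) (hZ.mdiffAt x)
        have h2 := leviCivitaFun_spec (g := g) (hX.mdiffAt x) hY (hZ.mdiffAt x)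
        rw [koszul_smul_middle hf (hX.mdiffAt x) hY (hZ.mdiffAt x)] at h1
        simp only [add_apply, map_add, smul_apply, map_smul, smul_eq_mul,
          ContinuousLinearMap.smulRight_apply]
        rw [lieD] at h1
        linear_combination (1 / 2 : ℝ) * h1 - (1 / 2 : ℝ) * f x * h2 }
  smooth _ _ hX hY := leviCivitaFun_smooth hX hY

end PseudoRiemannianMetric

namespace AffineConnection

variable {D D' : AffineConnection E M} {X Y Z : VField E M}

theorem torsion_apply_smooth (hX : IsSmooth X) (hY : IsSmooth Y) (x : M) :
    D.torsion x (X x) (Y x) = D.cov X Y x - D.cov Y X x - bracket X Y x :=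
  D.toCovariantDerivative.torsion_apply (hX.mdiffAt x) (hY.mdiffAt x)

theorem IsLeviCivita.bracket_eq {g : PseudoRiemannianMetric E M} (hD : IsLeviCivita g D)
    (hX : IsSmooth X) (hY : IsSmooth Y) (x : M) :
    bracket X Y x = D.cov X Y x - D.cov Y X x := by
  have h := torsion_apply_smooth (D := D) hX hY x
  rw [hD.2] at h
  exact (sub_eq_zero.1 h.symm).symm

/-- Metric compatibility expands the three derivatives and zero torsion the three brackets;
everything but `2 g(∇_X Y, Z)` cancels. Uniqueness follows. -/
theorem IsLeviCivita.koszul_eq {g : PseudoRiemannianMetric E M} (hD : IsLeviCivita g D)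
    (hX : IsSmooth X) (hY : IsSmooth Y) (hZ : IsSmooth Z) (x : M) :
    2 * g.val x (D.cov X Y x) (Z x) = g.koszul X Y Z x := by
  simp only [PseudoRiemannianMetric.koszul, hD.1 X Y Z hX hY hZ, hD.1 Y X Z hY hX hZ,
    hD.1 Z X Y hZ hX hY, hD.bracket_eq hX hY, hD.bracket_eq hX hZ, hD.bracket_eq hY hZ,
    NondegForm.pair, map_sub, sub_apply, g.symm x (X x), g.symm x (Y x)]
  ring

theorem IsLeviCivita.agree [T2Space M] {g : PseudoRiemannianMetric E M} (hD : IsLeviCivita g D)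
    (hD' : IsLeviCivita g D') : D.Agree D' := by
  intro X Y hX hY
  funext x
  refine g.ext_smooth fun Z hZ ↦ ?_
  linarith [hD.koszul_eq hX hY hZ x, hD'.koszul_eq hX hY hZ x]

end AffineConnection

theorem PseudoRiemannianMetric.isLeviCivita_leviCivita [T2Space M]
    (g : PseudoRiemannianMetric E M) : AffineConnection.IsLeviCivita g g.leviCivita := by
  constructor
  · intro X Y Z hX hY hZ x
    have h1 := leviCivitaFun_spec (g := g) (hX.mdiffAt x) (hY.mdiffAt x) (hZ.mdiffAt x)
    have h2 := leviCivitaFun_spec (g := g) (hX.mdiffAt x) (hZ.mdiffAt x) (hY.mdiffAt x)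
    rw [← mul_right_inj' (two_ne_zero' ℝ), ← koszul_add_swap, ← h1, ← h2]
    simp only [NondegForm.pair, g.symm x (Y x)]
    change _ = 2 * (g.val x (leviCivitaFun g Y x (X x)) (Z x)
      + g.val x (leviCivitaFun g Z x (X x)) (Y x))
    ring
  · refine (CovariantDerivative.torsion_eq_zero_iff _).2 fun {X Y x} hX hY ↦ ?_
    refine g.ext_smooth fun Z hZ ↦ ?_
    have h1 := leviCivitaFun_spec (g := g) hX hY (hZ.mdiffAt x)
    have h2 := leviCivitaFun_spec (g := g) hY hX (hZ.mdiffAt x)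
    have h3 := koszul_sub_swap (g := g) X Y Z x
    change g.val x (leviCivitaFun g Y x (X x) - leviCivitaFun g X x (Y x)) (Z x) = _
    rw [map_sub, sub_apply]
    linarith

theorem PseudoRiemannianMetric.existsUnique_leviCivita [T2Space M]
    (g : PseudoRiemannianMetric E M) :
    AffineConnection.ExistsUnique (AffineConnection.IsLeviCivita g) :=
  ⟨g.leviCivita, g.isLeviCivita_leviCivita, fun _ hD ↦ hD.agree g.isLeviCivita_leviCivita⟩

end LeviCivita

/-! ### Linearity rules, and integrability of the third structure from the other two. -/

section Linearity

variable {E : Type*} [NormedAddCommGroup E] [NormedSpace ℝ E]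
  {M : Type*} [TopologicalSpace M] [ChartedSpace E M]
  {X X' Y Y' : VField E M}

namespace EndField

variable (T : EndField E M)

theorem app_add (X Y : VField E M) : T.app (X + Y) = T.app X + T.app Y :=
  funext fun _ ↦ map_add _ _ _

theorem app_neg (X : VField E M) : T.app (-X) = -T.app X :=
  funext fun _ ↦ map_neg _ _

theorem app_smul (f : M → ℝ) (X : VField E M) : T.app (f • X) = f • T.app X :=
  funext fun _ ↦ map_smul _ _ _

theorem app_const_smul (c : ℝ) (X : VField E M) : T.app (c • X) = c • T.app X :=
  funext fun _ ↦ map_smul _ _ _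

end EndField

variable [IsManifold 𝓘(ℝ, E) ∞ M]

theorem bracket_const_smul_left [FiniteDimensional ℝ E] (c : ℝ) (hX : IsSmooth X)
    (Y : VField E M) (x : M) :
    bracket (c • X) Y x = c • bracket X Y x :=
  have : CompleteSpace E := FiniteDimensional.complete ℝ E
  VectorField.mlieBracket_const_smul_left (hX.mdiffAt x)

theorem bracket_const_smul_right [FiniteDimensional ℝ E] (c : ℝ) (X : VField E M)
    (hY : IsSmooth Y) (x : M) :
    bracket X (c • Y) x = c • bracket X Y x :=
  have : CompleteSpace E := FiniteDimensional.complete ℝ E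
  VectorField.mlieBracket_const_smul_right (hY.mdiffAt x)

theorem bracket_neg_left [FiniteDimensional ℝ E] (hX : IsSmooth X) (Y : VField E M) (x : M) :
    bracket (-X) Y x = -bracket X Y x := by
  simpa using! bracket_const_smul_left (-1) hX Y x

theorem bracket_neg_right [FiniteDimensional ℝ E] (X : VField E M) (hY : IsSmooth Y) (x : M) :
    bracket X (-Y) x = -bracket X Y x := by
  simpa using! bracket_const_smul_right (-1) X hY x

namespace AffineConnection

variable (D : AffineConnection E M)

theorem cov_add_left (X X' Y : VField E M) : D.cov (X + X') Y = D.cov X Y + D.cov X' Y :=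
  funext fun _ ↦ map_add _ _ _

variable {D}

theorem cov_add_right (X : VField E M) (hY : IsSmooth Y) (hY' : IsSmooth Y') :
    D.cov X (Y + Y') = D.cov X Y + D.cov X Y' := by
  funext x
  simp [cov, D.isCovariantDerivativeOnUniv.add (hY.mdiffAt x) (hY'.mdiffAt x)]

theorem cov_const_smul_right (c : ℝ) (X : VField E M) (hY : IsSmooth Y) :
    D.cov X (c • Y) = c • D.cov X Y := by
  funext x
  simp [cov, D.isCovariantDerivativeOnUniv.smul_const c (hY.mdiffAt x)]

theorem cov_neg_right (X : VField E M) (hY : IsSmooth Y) : D.cov X (-Y) = -D.cov X Y := by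
  simpa using cov_const_smul_right (D := D) (-1) X hY

end AffineConnection

/-- If two anticommuting involutions `A`, `B` are such that `B` and `J = BA` are integrable, then
so is `A`. -/
theorem EndField.isIntegrable_of_anticommute [FiniteDimensional ℝ E] {A B J : EndField E M}
    (hA : A.PreservesSmooth) (hB : B.PreservesSmooth) (hAA : ∀ x v, A x (A x v) = v)
    (hBB : ∀ x v, B x (B x v) = v)
    (hBA : ∀ x v, B x (A x v) = -A x (B x v)) (hJ : ∀ x v, J x v = -A x (B x v))
    (hNB : B.IsIntegrable) (hNJ : J.IsIntegrable) : A.IsIntegrable := by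
  intro X Y hX hY x
  have eA (Z : VField E M) : A.app (A.app Z) = Z := funext fun y ↦ hAA y _
  have eB (Z : VField E M) : B.app (B.app Z) = Z := funext fun y ↦ hBB y _
  have eBA (Z : VField E M) : B.app (A.app Z) = -A.app (B.app Z) := funext fun y ↦ hBA y _
  have eJ (Z : VField E M) : J.app Z = -A.app (B.app Z) := funext fun y ↦ hJ y _
  have hAX := hA X hX
  have hAY := hA Y hY
  have hBX := hB X hX
  have hBY := hB Y hY
  have hCX := hA _ hBX
  have hCY := hA _ hBY
  -- The arguments are moved by `A`, `B`, `AB` and the values by `A`, `B`, `AB`, so that only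
  -- brackets among the images of `X` and of `Y` occur. The signed sum of the eight identities is
  -- twice the Nijenhuis tensor of `A`.
  have n1 := congrArg (A x) (hNB _ _ hBX hCY x)
  have n2 := congrArg (B x) (hNB _ _ hX hBY x)
  have n3 := congrArg (A x) (hNB _ _ hAX hY x)
  have n4 := hNB _ _ hCX hCY x
  have n5 := congrArg (A x) (hNJ _ _ hCX hBY x)
  have n6 := congrArg (B x) (hNJ _ _ hAX hCY x)
  have n7 := hNJ _ _ hBX hBY x
  have n8 := congrArg (fun v ↦ A x (B x v)) (hNJ _ _ hCX hY x)
  simp only [nijenhuis, eJ, hJ, eB, eBA, eA, EndField.app_neg, neg_neg,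
    bracket_neg_left hAX, bracket_neg_right _ hAY,
    bracket_neg_left hCX, bracket_neg_right _ hCY,
    map_add, map_sub, map_neg, map_zero, hAA, hBB, hBA] at n1 n2 n3 n4 n5 n6 n7 n8 ⊢
  rw [← smul_right_inj (two_ne_zero' ℝ)]
  linear_combination (norm := module) n1 - n2 - n3 + n4 + n5 + n6 + n7 - n8

end Linearity

/-! ### Algebra of Born structures, and the Levi-Civita connection as Künneth connection. -/

section Born

variable {E : Type*} [NormedAddCommGroup E] [NormedSpace ℝ E] [FiniteDimensional ℝ E]
  {M : Type*} [TopologicalSpace M] [ChartedSpace E M] [IsManifold 𝓘(ℝ, E) ∞ M]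

theorem recursionOperator_preservesSmooth [T2Space M] (a b : NondegForm E M) :
    (recursionOperator a b).PreservesSmooth := by
  intro X hX
  refine a.isSmooth_of_pair fun W hW ↦ ?_
  have h : a.pair ((recursionOperator a b).app X) W = b.pair X W :=
    funext fun x ↦ recursionOperator_spec a b x _ _
  rw [h]
  exact b.pair_contMDiff hX hW

namespace AffineConnection

variable {D : AffineConnection E M} {X Y : VField E M}

/-- A connection that preserves two forms commutes with the recursion operator between them. -/
theorem IsParallel.cov_recursionOperator [T2Space M] {a b : NondegForm E M} (ha : D.IsParallel a)
    (hb : D.IsParallel b) (hX : IsSmooth X) (hY : IsSmooth Y) :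
    D.cov X ((recursionOperator a b).app Y) = (recursionOperator a b).app (D.cov X Y) := by
  funext x
  refine a.ext_smooth fun Z hZ ↦ ?_
  have h : a.pair ((recursionOperator a b).app Y) Z = b.pair Y Z :=
    funext fun x ↦ recursionOperator_spec a b x _ _
  have h1 := ha X _ Z hX (recursionOperator_preservesSmooth a b Y hY) hZ x
  have h2 := hb X Y Z hX hY hZ x
  rw [h] at h1
  simp only [NondegForm.pair, EndField.app, recursionOperator_spec] at h1 h2 ⊢
  linarith

theorem IsParallel.of_cov_recursionOperator [T2Space M] {a b : NondegForm E M}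
    (ha : D.IsParallel a) (hab : ∀ X Y : VField E M, IsSmooth X → IsSmooth Y →
      D.cov X ((recursionOperator a b).app Y) = (recursionOperator a b).app (D.cov X Y)) :
    D.IsParallel b := by
  intro X Y Z hX hY hZ x
  have h : a.pair ((recursionOperator a b).app Y) Z = b.pair Y Z :=
    funext fun x ↦ recursionOperator_spec a b x _ _
  have h1 := ha X _ Z hX (recursionOperator_preservesSmooth a b Y hY) hZ x
  rw [h, hab X Y hX hY] at h1
  simpa only [NondegForm.pair, EndField.app, recursionOperator_spec] using h1

end AffineConnection

namespace BornStructure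

variable (S : BornStructure E M)

theorem A_spec (x : M) (v w : TangentSpace 𝓘(ℝ, E) x) : S.g.val x (S.A x v) w = S.om.val x v w :=
  recursionOperator_spec _ _ _ _ _

theorem B_spec (x : M) (v w : TangentSpace 𝓘(ℝ, E) x) : S.g.val x (S.B x v) w = S.h.val x v w :=
  recursionOperator_spec _ _ _ _ _

theorem A_A (x : M) (v : TangentSpace 𝓘(ℝ, E) x) : S.A x (S.A x v) = v := S.sq_A x v

theorem B_B (x : M) (v : TangentSpace 𝓘(ℝ, E) x) : S.B x (S.B x v) = v := S.sq_B x v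

theorem J_J (x : M) (v : TangentSpace 𝓘(ℝ, E) x) : S.J x (S.J x v) = -v := S.sq_J x v

theorem g_A_left (x : M) (v w : TangentSpace 𝓘(ℝ, E) x) :
    S.g.val x (S.A x v) w = -S.g.val x v (S.A x w) := by
  rw [S.A_spec, S.om.alt, S.g.symm x v, S.A_spec]

theorem g_B_left (x : M) (v w : TangentSpace 𝓘(ℝ, E) x) :
    S.g.val x (S.B x v) w = S.g.val x v (S.B x w) := by
  rw [S.B_spec, S.h.symm, S.g.symm x v, S.B_spec]

/-- Pairing with `w`: `g(-AJv, w) = ω(-Jv, w) = h(v, w) = g(Bv, w)`, so `-AJ = B`. -/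
theorem J_eq (x : M) (v : TangentSpace 𝓘(ℝ, E) x) : S.J x v = -S.A x (S.B x v) := by
  have h : -S.A x (S.J x v) = S.B x v := by
    refine sub_eq_zero.1 (S.g.nondegenerate x _ fun w ↦ ?_)
    have := recursionOperator_spec S.om.toNondegForm S.h.toNondegForm x v w
    have hJ : -S.J x v = recursionOperator S.om.toNondegForm S.h.toNondegForm x v := neg_neg _
    rw [map_sub, sub_apply, S.B_spec, ← map_neg, S.A_spec, hJ, this, sub_self]
  rw [← h, map_neg, neg_neg, S.A_A]

/-- With `J = -AB`, the relation `J² = -Id` reads `ABAB = -Id`; compose with `BA` on the left. -/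
theorem B_A (x : M) (v : TangentSpace 𝓘(ℝ, E) x) : S.B x (S.A x v) = -S.A x (S.B x v) := by
  have h := S.J_J x v
  rw [S.J_eq, S.J_eq, map_neg, map_neg, neg_neg] at h
  have h2 := congrArg (fun u ↦ S.B x (S.A x u)) h
  simp only [S.A_A, S.B_B, map_neg] at h2
  rw [h2, neg_neg]

theorem A_preservesSmooth [T2Space M] : S.A.PreservesSmooth := recursionOperator_preservesSmooth _ _

theorem B_preservesSmooth [T2Space M] : S.B.PreservesSmooth := recursionOperator_preservesSmooth _ _

theorem J_preservesSmooth [T2Space M] : S.J.PreservesSmooth := fun X hX ↦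
  (recursionOperator_preservesSmooth S.om.toNondegForm S.h.toNondegForm X hX).neg

theorem IsIntegrable.A_isIntegrable [T2Space M] {S : BornStructure E M} (hS : S.IsIntegrable) :
    S.A.IsIntegrable := by
  rcases hS.2 with h | h | h
  · exact h.1
  · exact h.1
  · exact EndField.isIntegrable_of_anticommute S.A_preservesSmooth S.B_preservesSmooth S.A_A S.B_B
      S.B_A S.J_eq h.1 h.2

variable {S}

/-! ### Eigenfields of `A` -/

/-- Since `B` anticommutes with `A`, it interchanges the eigenbundles. A sign `ε` with `ε * ε = 1`
lets one argument serve both of them. -/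
theorem app_B_eigen {ε : ℝ} {Y : VField E M} (hY : S.A.app Y = ε • Y) :
    S.A.app (S.B.app Y) = (-ε) • S.B.app Y := by
  funext x
  have h := congrArg (S.B x) (congrFun hY x)
  simp only [EndField.app, Pi.smul_apply, map_smul, S.B_A] at h ⊢
  rw [neg_smul, ← h, neg_neg]

/-- Skewness of `A` makes each eigenbundle isotropic: `ε g(v, w) = -ε g(v, w)`. -/
theorem g_eq_zero_of_eigen {ε : ℝ} (hε : ε * ε = 1) {x : M} {v w : TangentSpace 𝓘(ℝ, E) x}
    (hv : S.A x v = ε • v) (hw : S.A x w = ε • w) : S.g.val x v w = 0 := by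
  have h := S.g_A_left x v w
  rw [hv, hw, map_smul, map_smul, smul_apply, smul_eq_mul] at h
  linear_combination (-S.g.val x v w) * hε + (1 / 2 : ℝ) * ε * h

variable (S) in
/-- The projection of a vector field to the `ε`-eigenbundle of `A`, for `ε = ±1`. -/
def proj (ε : ℝ) (X : VField E M) : VField E M := (1 / 2 : ℝ) • (X + ε • S.A.app X)

theorem isSmooth_proj [T2Space M] (ε : ℝ) {X : VField E M} (hX : IsSmooth X) :
    IsSmooth (S.proj ε X) :=
  (hX.add ((S.A_preservesSmooth X hX).const_smul ε)).const_smul _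

theorem app_A_proj {ε : ℝ} (hε : ε * ε = 1) (X : VField E M) :
    S.A.app (S.proj ε X) = ε • S.proj ε X := by
  have h : S.A.app (S.A.app X) = X := funext fun x ↦ S.A_A x _
  rw [proj, EndField.app_const_smul, EndField.app_add, EndField.app_const_smul, h]
  linear_combination (norm := module) -(1 / 2 : ℝ) • congrArg (fun c ↦ c • S.A.app X) hε

theorem proj_add_proj (ε : ℝ) (X : VField E M) : S.proj ε X + S.proj (-ε) X = X := by
  simp only [proj]
  module

theorem eq_zero_of_eigen {ε : ℝ} (hε : ε * ε = 1) {x : M} {v : TangentSpace 𝓘(ℝ, E) x}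
    (hv : S.A x v = ε • v) (hv' : S.A x v = (-ε) • v) : v = 0 := by
  rw [hv] at hv'
  have h : (2 * ε) • v = 0 := by
    rw [two_mul, add_smul]
    nth_rw 1 [hv']
    simp
  refine (smul_eq_zero.1 h).resolve_left fun h0 ↦ ?_
  have : ε = 0 := by linarith
  simp [this] at hε

/-- Vectors can be tested against eigenfields of `A`. -/
theorem ext_eigen [T2Space M] {ε : ℝ} (hε : ε * ε = 1) {x : M} {v w : TangentSpace 𝓘(ℝ, E) x}
    (h : ∀ Z, IsSmooth Z → S.A.app Z = ε • Z → S.g.val x v (Z x) = S.g.val x w (Z x))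
    (h' : ∀ Z, IsSmooth Z → S.A.app Z = (-ε) • Z → S.g.val x v (Z x) = S.g.val x w (Z x)) :
    v = w := by
  refine S.g.ext_smooth fun Z hZ ↦ ?_
  have hε' : -ε * -ε = 1 := by simpa using hε
  have h1 := h _ (isSmooth_proj ε hZ) (app_A_proj hε Z)
  have h2 := h' _ (isSmooth_proj (-ε) hZ) (app_A_proj hε' Z)
  have e := congrFun (S.proj_add_proj ε Z) x
  rw [← e, Pi.add_apply, map_add, map_add, h1, h2]

/-- Additive properties of vector fields can be checked on eigenfields of `A`. -/
theorem eigen_induction [T2Space M] {p : VField E M → Prop} (ε : ℝ) (hε : ε * ε = 1)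
    (h : ∀ X, IsSmooth X → S.A.app X = ε • X → p X)
    (h' : ∀ X, IsSmooth X → S.A.app X = (-ε) • X → p X)
    (hadd : ∀ X X', IsSmooth X → IsSmooth X' → p X → p X' → p (X + X')) {X : VField E M}
    (hX : IsSmooth X) : p X := by
  have hε' : -ε * -ε = 1 := by simpa using hε
  rw [← S.proj_add_proj ε X]
  exact hadd _ _ (isSmooth_proj ε hX) (isSmooth_proj _ hX)
    (h _ (isSmooth_proj ε hX) (app_A_proj hε X)) (h' _ (isSmooth_proj _ hX) (app_A_proj hε' X))

/-! ### The Levi-Civita connection when `A` is integrable -/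

/-- On `ε`-eigenfields the Nijenhuis tensor reduces to `2([X, Y] - ε A[X, Y])`, so integrability
makes the eigenbundles involutive. -/
theorem bracket_eigen (hA : S.A.IsIntegrable) {ε : ℝ} (hε : ε * ε = 1) {X Y : VField E M}
    (hX : IsSmooth X) (hY : IsSmooth Y) (hAX : S.A.app X = ε • X) (hAY : S.A.app Y = ε • Y)
    (x : M) : S.A x (bracket X Y x) = ε • bracket X Y x := by
  have h := hA X Y hX hY x
  simp only [nijenhuis, hAX, hAY, bracket_const_smul_left ε hX,
    bracket_const_smul_right ε _ hY, map_smul, S.A_A, smul_smul, hε] at h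
  have h2 := congrArg (fun v ↦ ((1 / 2 : ℝ) * ε) • v) h
  have e : ε • bracket X Y x = (ε * (ε * ε)) • bracket X Y x := by rw [hε, mul_one]
  simp only [smul_sub, smul_add, smul_smul, smul_zero] at h2
  have e2 : S.A x (bracket X Y x) = (ε * ε) • S.A x (bracket X Y x) := by rw [hε, one_smul]
  rw [e2]
  linear_combination (norm := module) -h2

variable {D : AffineConnection E M}

theorem g_cov_skew (hD : D.IsParallel S.g.toNondegForm) {ε : ℝ} (hε : ε * ε = 1)
    {X Y Z : VField E M} (hX : IsSmooth X) (hY : IsSmooth Y) (hZ : IsSmooth Z)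
    (hAY : S.A.app Y = ε • Y) (hAZ : S.A.app Z = ε • Z) (x : M) :
    S.g.val x (D.cov X Y x) (Z x) + S.g.val x (Y x) (D.cov X Z x) = 0 := by
  have h0 : S.g.pair Y Z = 0 :=
    funext fun y ↦ g_eq_zero_of_eigen hε (congrFun hAY y) (congrFun hAZ y)
  have h := hD X Y Z hX hY hZ x
  rw [h0, lieD_zero] at h
  exact h.symm

/-- Rewriting `ω` as `g(A·,·)` and brackets as covariant differences, `dω(X, Y, Z)` collapses to `ε
(g(∇_X Y, Z) - g(∇_X Z, Y))`. Closedness thus gives symmetry in `Y, Z`, while isotropy gives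
skewness. -/
theorem g_cov_eq_zero_of_neg (hD : AffineConnection.IsLeviCivita S.g D) (hom : S.om.IsClosed)
    {ε : ℝ} (hε : ε * ε = 1) {X Y Z : VField E M} (hX : IsSmooth X) (hY : IsSmooth Y)
    (hZ : IsSmooth Z) (hAX : S.A.app X = (-ε) • X) (hAY : S.A.app Y = ε • Y)
    (hAZ : S.A.app Z = ε • Z) (x : M) : S.g.val x (D.cov X Y x) (Z x) = 0 := by
  have hpair (U V : VField E M) : S.om.pair U V = S.g.pair (S.A.app U) V :=
    funext fun y ↦ (S.A_spec y _ _).symm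
  have hYZ : S.om.pair Y Z = 0 := by
    rw [hpair, hAY]
    funext y
    simpa [NondegForm.pair] using
      Or.inr (g_eq_zero_of_eigen hε (congrFun hAY y) (congrFun hAZ y))
  have hval (U : VField E M) (c : ℝ) (hU : S.A.app U = c • U) (v : TangentSpace 𝓘(ℝ, E) x) :
      S.om.val x v (U x) = -(c * S.g.val x v (U x)) := by
    have e : S.A x (U x) = c • U x := congrFun hU x
    rw [S.om.alt, ← S.A_spec, e, map_smul, smul_apply, smul_eq_mul, S.g.symm]
  have hd := hom X Y Z hX hY hZ x
  have hs := g_cov_skew (X := X) hD.1 hε hX hY hZ hAY hAZ x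
  rw [NondegTwoForm.extDeriv, hYZ, lieD_zero, hpair X, hpair X, hAX,
    hD.1 _ _ _ hY (hX.const_smul _) hZ, hD.1 _ _ _ hZ (hX.const_smul _) hY,
    AffineConnection.cov_const_smul_right _ _ hX,
    AffineConnection.cov_const_smul_right _ _ hX] at hd
  simp only [NondegForm.pair, hval X _ hAX, hval Y _ hAY, hval Z _ hAZ, hD.bracket_eq hX hY,
    hD.bracket_eq hX hZ, hD.bracket_eq hY hZ, Pi.smul_apply, map_smul, map_sub, sub_apply,
    smul_apply, smul_eq_mul] at hd
  have e1 := S.g.symm x (X x) (D.cov Y Z x)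
  have e2 := S.g.symm x (X x) (D.cov Z Y x)
  have e3 := S.g.symm x (Y x) (D.cov X Z x)
  rw [e3] at hs
  rw [e1, e2] at hd
  linear_combination (1 / 2 : ℝ) * hs + (1 / 2 : ℝ) * ε * hd -
    (1 / 2 : ℝ) * (S.g.val x (D.cov X Y x) (Z x) - S.g.val x (D.cov X Z x) (Y x)) * hε

/-- On one eigenbundle, `g(∇_U V, W)` is skew in `V, W` by isotropy and symmetric in `U, V` by
involutivity. Six alternating swaps return it to itself with a minus sign. -/
theorem g_cov_eq_zero_of_pos (hD : AffineConnection.IsLeviCivita S.g D) (hA : S.A.IsIntegrable)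
    {ε : ℝ} (hε : ε * ε = 1) {X Y Z : VField E M} (hX : IsSmooth X) (hY : IsSmooth Y)
    (hZ : IsSmooth Z) (hAX : S.A.app X = ε • X) (hAY : S.A.app Y = ε • Y)
    (hAZ : S.A.app Z = ε • Z) (x : M) : S.g.val x (D.cov X Y x) (Z x) = 0 := by
  have skew : ∀ U V W : VField E M, IsSmooth U → IsSmooth V → IsSmooth W → S.A.app V = ε • V →
      S.A.app W = ε • W →
        S.g.val x (D.cov U V x) (W x) = -S.g.val x (D.cov U W x) (V x) := by
    intro U V W hU hV hW hAV hAW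
    have := g_cov_skew (X := U) hD.1 hε hU hV hW hAV hAW x
    rw [S.g.symm x (V x)] at this
    linarith
  have sym : ∀ U V W : VField E M, IsSmooth U → IsSmooth V → S.A.app U = ε • U →
      S.A.app V = ε • V → S.A.app W = ε • W →
        S.g.val x (D.cov U V x) (W x) = S.g.val x (D.cov V U x) (W x) := by
    intro U V W hU hV hAU hAV hAW
    have := g_eq_zero_of_eigen hε (bracket_eigen hA hε hU hV hAU hAV x) (congrFun hAW x)
    rw [hD.bracket_eq hU hV, map_sub, sub_apply] at this
    linarith
  have h1 := skew X Y Z hX hY hZ hAY hAZ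
  have h2 := sym X Z Y hX hZ hAX hAZ hAY
  have h3 := skew Z X Y hZ hX hY hAX hAY
  have h4 := sym Z Y X hZ hY hAZ hAY hAX
  have h5 := skew Y Z X hY hZ hX hAZ hAX
  have h6 := sym Y X Z hY hX hAY hAX hAZ
  linarith

theorem cov_eigen [T2Space M] (hD : AffineConnection.IsLeviCivita S.g D) (hom : S.om.IsClosed)
    (hA : S.A.IsIntegrable) {ε : ℝ} (hε : ε * ε = 1) {X Y : VField E M} (hX : IsSmooth X)
    (hY : IsSmooth Y) (hAY : S.A.app Y = ε • Y) : S.A.app (D.cov X Y) = ε • D.cov X Y := by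
  have key : ∀ Z, IsSmooth Z → S.A.app Z = ε • Z → ∀ x, S.g.val x (D.cov X Y x) (Z x) = 0 := by
    intro Z hZ hAZ x
    refine eigen_induction (S := S) (p := fun X ↦ S.g.val x (D.cov X Y x) (Z x) = 0) ε hε ?_ ?_ ?_
      hX
    · exact fun X hX hAX ↦ g_cov_eq_zero_of_pos hD hA hε hX hY hZ hAX hAY hAZ x
    · exact fun X hX hAX ↦ g_cov_eq_zero_of_neg hD hom hε hX hY hZ hAX hAY hAZ x
    · intro X X' _ _ h h'
      rw [D.cov_add_left, Pi.add_apply, map_add, add_apply, h, h', add_zero]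
  funext x
  change S.A x (D.cov X Y x) = ε • D.cov X Y x
  -- Against `ε`-eigenfields both sides vanish by `key`; against `(-ε)`-eigenfields they agree by
  -- skewness of `A`.
  refine ext_eigen (S := S) hε ?_ ?_ <;> intro Z hZ hAZ <;>
    have e := congrFun hAZ x <;>
    simp only [EndField.app, Pi.smul_apply] at e <;>
    rw [S.g_A_left, e, map_smul, map_smul, smul_apply, smul_eq_mul]
  · rw [key Z hZ hAZ]
    simp
  · ring

theorem cov_A [T2Space M] (hD : AffineConnection.IsLeviCivita S.g D) (hom : S.om.IsClosed)
    (hA : S.A.IsIntegrable) {X Y : VField E M} (hX : IsSmooth X) (hY : IsSmooth Y) :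
    D.cov X (S.A.app Y) = S.A.app (D.cov X Y) := by
  refine eigen_induction (S := S) (p := fun Y ↦ D.cov X (S.A.app Y) = S.A.app (D.cov X Y)) 1
    (by norm_num) ?_ ?_ ?_ hY
  · intro Y hY hAY
    rw [cov_eigen hD hom hA (by norm_num) hX hY hAY, hAY,
      AffineConnection.cov_const_smul_right _ _ hY]
  · intro Y hY hAY
    rw [cov_eigen hD hom hA (by norm_num) hX hY hAY, hAY,
      AffineConnection.cov_const_smul_right _ _ hY]
  · intro Y Y' hY hY' h h'
    rw [EndField.app_add, AffineConnection.cov_add_right _ (S.A_preservesSmooth Y hY)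
      (S.A_preservesSmooth Y' hY'), AffineConnection.cov_add_right _ hY hY', EndField.app_add,
      h, h']

/-! ### The Künneth connection -/

theorem mem_Lplus_iff {Y : VField E M} : (∀ x, Y x ∈ S.Lplus x) ↔ S.A.app Y = (1 : ℝ) • Y := by
  simp only [Lplus, Module.End.mem_eigenspace_iff, funext_iff]
  rfl

theorem mem_Lminus_iff {Y : VField E M} :
    (∀ x, Y x ∈ S.Lminus x) ↔ S.A.app Y = (-1 : ℝ) • Y := by
  simp only [Lminus, Module.End.mem_eigenspace_iff, funext_iff]
  rfl

theorem isKunnethConnection_of_isLeviCivita [T2Space M] (hD : AffineConnection.IsLeviCivita S.g D)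
    (hom : S.om.IsClosed) (hA : S.A.IsIntegrable) : S.IsKunnethConnection D := by
  refine ⟨?_, ?_, ?_, ?_⟩
  · intro X Y hX hY h
    exact mem_Lplus_iff.2 (cov_eigen hD hom hA (by norm_num) hX hY (mem_Lplus_iff.1 h))
  · intro X Y hX hY h
    exact mem_Lminus_iff.2 (cov_eigen hD hom hA (by norm_num) hX hY (mem_Lminus_iff.1 h))
  · exact hD.1.of_cov_recursionOperator fun X Y hX hY ↦ cov_A hD hom hA hX hY
  · intro x u _ v _
    rw [hD.2]
    exact ⟨rfl, rfl⟩

theorem IsKunnethConnection.cov_eigen (hD : S.IsKunnethConnection D) {ε : ℝ} (hε : ε * ε = 1)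
    {X Y : VField E M} (hX : IsSmooth X) (hY : IsSmooth Y) (hAY : S.A.app Y = ε • Y) :
    S.A.app (D.cov X Y) = ε • D.cov X Y := by
  rcases mul_self_eq_one_iff.1 hε with rfl | rfl
  · exact mem_Lplus_iff.1 (hD.1 X Y hX hY (mem_Lplus_iff.2 hAY))
  · exact mem_Lminus_iff.1 (hD.2.1 X Y hX hY (mem_Lminus_iff.2 hAY))

theorem IsKunnethConnection.bracket_eq (hD : S.IsKunnethConnection D) {ε : ℝ} (hε : ε * ε = 1)
    {X Y : VField E M} (hX : IsSmooth X) (hY : IsSmooth Y) (hAX : S.A.app X = ε • X)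
    (hAY : S.A.app Y = (-ε) • Y) (x : M) : bracket X Y x = D.cov X Y x - D.cov Y X x := by
  have h := AffineConnection.torsion_apply_smooth (D := D) hX hY x
  have h0 : D.torsion x (X x) (Y x) = 0 := by
    rcases mul_self_eq_one_iff.1 hε with rfl | rfl
    · exact (hD.2.2.2 x _ (mem_Lplus_iff.2 hAX x) _ (mem_Lminus_iff.2 hAY x)).1
    · rw [neg_neg] at hAY
      exact (hD.2.2.2 x _ (mem_Lplus_iff.2 hAY x) _ (mem_Lminus_iff.2 hAX x)).2
  rw [h0] at h
  exact (sub_eq_zero.1 h.symm).symm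

/-- For `X`, `Y` in opposite eigenbundles, `∇_X Y` and `-∇_Y X` are the eigencomponents of `[X, Y]`,
hence determined. For `X`, `Y` in the same one, `∇ω = 0` expresses `ω(∇_X Y, Z)` through a mixed
derivative `∇_X Z`. -/
theorem IsKunnethConnection.agree [T2Space M] {D' : AffineConnection E M}
    (hD : S.IsKunnethConnection D) (hD' : S.IsKunnethConnection D') : D.Agree D' := by
  have mixed : ∀ ε : ℝ, ε * ε = 1 → ∀ X Y : VField E M, IsSmooth X → IsSmooth Y →
      S.A.app X = ε • X → S.A.app Y = (-ε) • Y → D.cov X Y = D'.cov X Y := by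
    intro ε hε X Y hX hY hAX hAY
    have hε' : -ε * -ε = 1 := by simpa using hε
    funext x
    have h1 := hD.bracket_eq hε hX hY hAX hAY x
    have h2 := hD'.bracket_eq hε hX hY hAX hAY x
    have a1 := congrFun (hD.cov_eigen hε' hX hY hAY) x
    have a2 := congrFun (hD'.cov_eigen hε' hX hY hAY) x
    have a3 := congrFun (hD.cov_eigen hε hY hX hAX) x
    have a4 := congrFun (hD'.cov_eigen hε hY hX hAX) x
    simp only [EndField.app, Pi.smul_apply] at a1 a2 a3 a4
    have h3 : D.cov X Y x - D'.cov X Y x = D.cov Y X x - D'.cov Y X x := by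
      linear_combination (norm := module) h2 - h1
    -- By `h3` the difference lies in both eigenbundles.
    refine sub_eq_zero.1 (eq_zero_of_eigen (S := S) hε ?_ ?_)
    · rw [h3, map_sub, a3, a4, smul_sub]
    · rw [map_sub, a1, a2, smul_sub]
  have same : ∀ ε : ℝ, ε * ε = 1 → ∀ X Y : VField E M, IsSmooth X → IsSmooth Y →
      S.A.app X = ε • X → S.A.app Y = ε • Y → D.cov X Y = D'.cov X Y := by
    intro ε hε X Y hX hY hAX hAY
    funext x
    refine ext_eigen (S := S) hε ?_ ?_ <;> intro Z hZ hAZ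
    · rw [g_eq_zero_of_eigen hε (congrFun (hD.cov_eigen hε hX hY hAY) x) (congrFun hAZ x),
        g_eq_zero_of_eigen hε (congrFun (hD'.cov_eigen hε hX hY hAY) x) (congrFun hAZ x)]
    · have h1 := hD.2.2.1 X Y Z hX hY hZ x
      have h2 := hD'.2.2.1 X Y Z hX hY hZ x
      have a1 := congrFun (hD.cov_eigen hε hX hY hAY) x
      have a2 := congrFun (hD'.cov_eigen hε hX hY hAY) x
      simp only [EndField.app, Pi.smul_apply] at a1 a2
      rw [mixed ε hε X Z hX hZ hAX hAZ] at h1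
      simp only [NondegForm.pair, ← S.A_spec, a1, a2, map_smul, smul_apply, smul_eq_mul] at h1 h2
      have h3 := h1.symm.trans h2
      have hne : ε ≠ 0 := by rintro rfl; simp at hε
      exact mul_left_cancel₀ hne (add_right_cancel h3)
  have step : ∀ ε : ℝ, ε * ε = 1 → ∀ X Y : VField E M, IsSmooth X → IsSmooth Y →
      S.A.app Y = ε • Y → D.cov X Y = D'.cov X Y := by
    intro ε hε X Y hX hY hAY
    have hε' : -ε * -ε = 1 := by simpa using hε
    refine eigen_induction (S := S) (p := fun X ↦ D.cov X Y = D'.cov X Y) ε hε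
      (fun X hX hAX ↦ same ε hε X Y hX hY hAX hAY)
      (fun X hX hAX ↦ mixed (-ε) hε' X Y hX hY hAX (by simpa using hAY)) ?_ hX
    intro X X' _ _ h h'
    rw [D.cov_add_left, D'.cov_add_left, h, h']
  intro X Y hX hY
  refine eigen_induction (S := S) (p := fun Y ↦ D.cov X Y = D'.cov X Y) 1 (by norm_num)
    (fun Y hY ↦ step 1 (by norm_num) X Y hX hY) (fun Y hY ↦ step (-1) (by norm_num) X Y hX hY)
    ?_ hY
  intro Y Y' hY hY' h h'
  rw [AffineConnection.cov_add_right _ hY hY', AffineConnection.cov_add_right _ hY hY', h, h']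

end BornStructure

end Born

/-! ### Averaging under `B`, generalized torsion, and uniqueness of the Born connection. -/

section BornConnection

variable {E : Type*} [NormedAddCommGroup E] [NormedSpace ℝ E] [FiniteDimensional ℝ E]
  {M : Type*} [TopologicalSpace M] [ChartedSpace E M] [IsManifold 𝓘(ℝ, E) ∞ M]

namespace AffineConnection

/-- The average of a connection under conjugation with a field of involutions. -/
def conjAverage [T2Space M] (D : AffineConnection E M) (T : EndField E M) (hT : T.PreservesSmooth)
    (hTT : ∀ x v, T x (T x v) = v) : AffineConnection E M where
  toFun Y x := (1 / 2 : ℝ) • (D.toFun Y x + T x ∘L D.toFun (T.app Y) x)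
  isCovariantDerivativeOnUniv :=
    { add := by
        intro Y Y' x hY hY' _
        rw [EndField.app_add, D.isCovariantDerivativeOnUniv.add hY hY',
          D.isCovariantDerivativeOnUniv.add (hT.mdiffAt hY) (hT.mdiffAt hY')]
        ext v
        simp only [add_apply, smul_apply, ContinuousLinearMap.comp_apply, map_add]
        module
      leibniz := by
        intro Y f x hY hf _
        rw [EndField.app_smul, D.isCovariantDerivativeOnUniv.leibniz hY hf,
          D.isCovariantDerivativeOnUniv.leibniz (hT.mdiffAt hY) hf]
        -- As `T` squares to the identity, each half contributes the same Leibniz term `df ⊗ Y`.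
        ext v
        simp only [add_apply, smul_apply, ContinuousLinearMap.comp_apply, map_add, map_smul,
          ContinuousLinearMap.smulRight_apply, EndField.app, hTT]
        module }
  smooth X Y hX hY := by
    exact ((D.smooth X Y hX hY).add (hT _ (D.smooth X _ hX (hT Y hY)))).const_smul (1 / 2 : ℝ)

variable {D : AffineConnection E M} {T : EndField E M} {hT : T.PreservesSmooth}
  {hTT : ∀ x v, T x (T x v) = v}

theorem conjAverage_cov [T2Space M] (X Y : VField E M) :
    (D.conjAverage T hT hTT).cov X Y = (1 / 2 : ℝ) • (D.cov X Y + T.app (D.cov X (T.app Y))) :=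
  rfl

theorem conjAverage_cov_app [T2Space M] (X Y : VField E M) :
    (D.conjAverage T hT hTT).cov X (T.app Y) = T.app ((D.conjAverage T hT hTT).cov X Y) := by
  have e (Z : VField E M) : T.app (T.app Z) = Z := funext fun y ↦ hTT y _
  rw [conjAverage_cov, conjAverage_cov, EndField.app_const_smul, EndField.app_add, e, e, add_comm]

end AffineConnection

namespace BornStructure

variable {S : BornStructure E M} {D D' : AffineConnection E M} {X Y Z : VField E M}

variable (S) in
/-- The conjugation average of a connection under `B`. -/
def averageB [T2Space M] (D : AffineConnection E M) : AffineConnection E M :=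
  D.conjAverage S.B S.B_preservesSmooth S.B_B

/-- `B` is a `g`-isometry, so the conjugate connection, and with it the average, preserves `g`. The
average commutes with `B` by construction. It commutes with `A` because the two signs from `AB =
-BA` cancel. -/
theorem isCompatible_averageB [T2Space M] (hD : D.IsParallel S.g.toNondegForm)
    (hA : ∀ X Y, IsSmooth X → IsSmooth Y → D.cov X (S.A.app Y) = S.A.app (D.cov X Y)) :
    S.IsCompatible (S.averageB D) := by
  have hg : (S.averageB D).IsParallel S.g.toNondegForm := by
    intro X Y Z hX hY hZ x
    have hBB : S.g.pair (S.B.app Y) (S.B.app Z) = S.g.pair Y Z := by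
      funext y
      simp only [NondegForm.pair, EndField.app, S.g_B_left, S.B_B]
    have h1 := hD X Y Z hX hY hZ x
    have h2 := hD X _ _ hX (S.B_preservesSmooth Y hY) (S.B_preservesSmooth Z hZ) x
    rw [hBB] at h2
    simp only [averageB, AffineConnection.conjAverage_cov, NondegForm.pair, EndField.app,
      Pi.smul_apply, Pi.add_apply, map_smul, map_add, smul_apply, add_apply, smul_eq_mul,
      S.g_B_left] at h1 h2 ⊢
    linarith
  refine ⟨hg, ?_, ?_⟩
  · exact hg.of_cov_recursionOperator fun X Y _ _ ↦ AffineConnection.conjAverage_cov_app X Y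
  · refine hg.of_cov_recursionOperator fun X Y hX hY ↦ ?_
    change (S.averageB D).cov X (S.A.app Y) = S.A.app ((S.averageB D).cov X Y)
    have e (V : VField E M) : S.B.app (S.A.app V) = -S.A.app (S.B.app V) := funext fun y ↦ S.B_A y _
    have hBY := S.B_preservesSmooth Y hY
    rw [averageB, AffineConnection.conjAverage_cov, AffineConnection.conjAverage_cov, e,
      AffineConnection.cov_neg_right _ (S.A_preservesSmooth _ hBY), hA X Y hX hY, hA X _ hX hBY,
      EndField.app_neg, e, neg_neg, EndField.app_const_smul, EndField.app_add]

variable (S D) in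
/-- The generalized torsion of a connection, before subtracting that of the canonical one. -/
def genTorsion (X Y Z : VField E M) (x : M) : ℝ :=
  S.g.val x (D.cov X Y x - D.cov Y X x) (Z x) + S.g.val x (D.cov Z X x) (Y x)

theorem genTorsion_add_left {X' : VField E M} (hX : IsSmooth X) (hX' : IsSmooth X')
    (Y Z : VField E M) (x : M) :
    S.genTorsion D (X + X') Y Z x = S.genTorsion D X Y Z x + S.genTorsion D X' Y Z x := by
  simp only [genTorsion, AffineConnection.cov_add_right _ hX hX', Pi.add_apply, map_add, map_sub,
    AffineConnection.cov_add_left, add_apply, sub_apply]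
  ring

theorem genTorsion_add_middle {Y' : VField E M} (X : VField E M) (hY : IsSmooth Y)
    (hY' : IsSmooth Y') (Z : VField E M) (x : M) :
    S.genTorsion D X (Y + Y') Z x = S.genTorsion D X Y Z x + S.genTorsion D X Y' Z x := by
  simp only [genTorsion, AffineConnection.cov_add_right _ hY hY', Pi.add_apply, map_add, map_sub,
    AffineConnection.cov_add_left, add_apply, sub_apply]
  ring

theorem genTorsion_add_right (X Y Z Z' : VField E M) (x : M) :
    S.genTorsion D X Y (Z + Z') x = S.genTorsion D X Y Z x + S.genTorsion D X Y Z' x := by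
  simp only [genTorsion, Pi.add_apply, map_add, AffineConnection.cov_add_left, add_apply]
  ring

theorem cov_eigen_of_cov_A
    (hA : ∀ X Y, IsSmooth X → IsSmooth Y → D.cov X (S.A.app Y) = S.A.app (D.cov X Y)) {ε : ℝ}
    (hX : IsSmooth X) (hY : IsSmooth Y) (hAY : S.A.app Y = ε • Y) :
    S.A.app (D.cov X Y) = ε • D.cov X Y := by
  rw [← hA X Y hX hY, hAY, AffineConnection.cov_const_smul_right _ _ hY]

/-- The difference of two connections preserving `g` is skew-symmetric. -/
theorem g_cov_add_swap (hg : D.IsParallel S.g.toNondegForm) (hg' : D'.IsParallel S.g.toNondegForm)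
    (hX : IsSmooth X) (hY : IsSmooth Y) (hZ : IsSmooth Z) (x : M) :
    S.g.val x (D.cov X Y x) (Z x) + S.g.val x (D.cov X Z x) (Y x) =
      S.g.val x (D'.cov X Y x) (Z x) + S.g.val x (D'.cov X Z x) (Y x) := by
  have := (hg X Y Z hX hY hZ x).symm.trans (hg' X Y Z hX hY hZ x)
  simpa only [NondegForm.pair, S.g.symm x (Y x)] using this

/-- For connections preserving `g` and `A`, the generalized torsions agree if the torsions agree on
each eigenbundle of `A`. -/
theorem genTorsion_eq [T2Space M] (hg : D.IsParallel S.g.toNondegForm)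
    (hg' : D'.IsParallel S.g.toNondegForm)
    (hA : ∀ X Y, IsSmooth X → IsSmooth Y → D.cov X (S.A.app Y) = S.A.app (D.cov X Y))
    (hA' : ∀ X Y, IsSmooth X → IsSmooth Y → D'.cov X (S.A.app Y) = S.A.app (D'.cov X Y))
    (hsym : ∀ ε : ℝ, ε * ε = 1 → ∀ X Y : VField E M, IsSmooth X → IsSmooth Y →
      S.A.app X = ε • X → S.A.app Y = ε • Y →
        ∀ x, D.cov X Y x - D.cov Y X x = D'.cov X Y x - D'.cov Y X x)
    (hX : IsSmooth X) (hY : IsSmooth Y) (hZ : IsSmooth Z) (x : M) :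
    S.genTorsion D X Y Z x = S.genTorsion D' X Y Z x := by
  have vanish : ∀ ε : ℝ, ε * ε = 1 → ∀ U V W : VField E M, IsSmooth U → IsSmooth V →
      S.A.app V = ε • V → S.A.app W = ε • W → S.g.val x (D.cov U V x) (W x) = 0 ∧
        S.g.val x (D'.cov U V x) (W x) = 0 := fun ε hε U V W hU hV hAV hAW ↦
    ⟨g_eq_zero_of_eigen hε (congrFun (cov_eigen_of_cov_A hA hU hV hAV) x) (congrFun hAW x),
      g_eq_zero_of_eigen hε (congrFun (cov_eigen_of_cov_A hA' hU hV hAV) x) (congrFun hAW x)⟩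
  have skew := fun U V W (hU : IsSmooth U) (hV : IsSmooth V) (hW : IsSmooth W) ↦
    g_cov_add_swap hg hg' hU hV hW x
  have sym : ∀ ε : ℝ, ε * ε = 1 → ∀ U V W : VField E M, IsSmooth U → IsSmooth V →
      S.A.app U = ε • U → S.A.app V = ε • V →
        S.g.val x (D.cov U V x) (W x) - S.g.val x (D.cov V U x) (W x) =
          S.g.val x (D'.cov U V x) (W x) - S.g.val x (D'.cov V U x) (W x) := by
    intro ε hε U V W hU hV hAU hAV
    simpa only [map_sub, sub_apply] using
      congrArg (fun v ↦ S.g.val x v (W x)) (hsym ε hε U V hU hV hAU hAV x)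
  have same : ∀ ε : ℝ, ε * ε = 1 → ∀ X Y : VField E M, IsSmooth X → IsSmooth Y →
      S.A.app X = ε • X → S.A.app Y = ε • Y →
        S.genTorsion D X Y Z x = S.genTorsion D' X Y Z x := by
    intro ε hε X Y hX hY hAX hAY
    -- The term `g(∇_Z X, Y)` vanishes by isotropy, leaving the torsion of `X, Y`.
    have h1 := sym ε hε X Y Z hX hY hAX hAY
    have h2 := vanish ε hε Z X Y hZ hX hAX hAY
    simp only [genTorsion, map_sub, sub_apply]
    linarith
  have mixed : ∀ ε : ℝ, ε * ε = 1 → ∀ X Y : VField E M, IsSmooth X → IsSmooth Y →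
      S.A.app X = ε • X → S.A.app Y = (-ε) • Y →
        S.genTorsion D X Y Z x = S.genTorsion D' X Y Z x := by
    intro ε hε X Y hX hY hAX hAY
    have hε' : -ε * -ε = 1 := by simpa using hε
    refine eigen_induction (S := S)
      (p := fun Z ↦ S.genTorsion D X Y Z x = S.genTorsion D' X Y Z x) ε hε ?_ ?_ ?_ hZ
    · intro Z hZ hAZ
      -- Here `g(∇_Y X, Z)` vanishes, and skewness turns the rest into the torsion of `X, Z` tested
      -- against `Y`.
      have h1 := vanish ε hε Y X Z hY hX hAX hAZ
      have h2 := sym ε hε X Z Y hX hZ hAX hAZ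
      have h3 := skew X Y Z hX hY hZ
      simp only [genTorsion, map_sub, sub_apply]
      linarith
    · intro Z hZ hAZ
      -- Here `g(∇_X Y, Z)` vanishes, and the rest becomes the torsion of `Y, Z` tested against `X`.
      have h1 := vanish (-ε) hε' X Y Z hX hY hAY hAZ
      have h2 := sym (-ε) hε' Y Z X hY hZ hAY hAZ
      have h3 := skew Y X Z hY hX hZ
      have h4 := skew Z X Y hZ hX hY
      simp only [genTorsion, map_sub, sub_apply]
      linarith
    · intro Z Z' _ _ h h'
      rw [genTorsion_add_right, genTorsion_add_right, h, h']
  have step : ∀ ε : ℝ, ε * ε = 1 → ∀ X : VField E M, IsSmooth X → S.A.app X = ε • X →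
      S.genTorsion D X Y Z x = S.genTorsion D' X Y Z x := by
    intro ε hε X hX hAX
    refine eigen_induction (S := S)
      (p := fun Y ↦ S.genTorsion D X Y Z x = S.genTorsion D' X Y Z x) ε hε ?_ ?_ ?_ hY
    · exact fun Y hY hAY ↦ same ε hε X Y hX hY hAX hAY
    · exact fun Y hY hAY ↦ mixed ε hε X Y hX hY hAX hAY
    · intro Y Y' hY hY' h h'
      rw [genTorsion_add_middle _ hY hY', genTorsion_add_middle _ hY hY', h, h']
  refine eigen_induction (S := S)
    (p := fun X ↦ S.genTorsion D X Y Z x = S.genTorsion D' X Y Z x) 1 (by norm_num)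
    (step 1 (by norm_num)) (step (-1) (by norm_num)) ?_ hX
  intro X X' hX hX' h h'
  rw [genTorsion_add_left hX hX', genTorsion_add_left hX hX', h, h']

/-- If `B` or `J` is integrable, then averaging the Levi-Civita connection under `B` does not change
the torsion on the eigenbundles of `A`. -/
theorem averageB_torsion_eigen [T2Space M] (hD : AffineConnection.IsLeviCivita S.g D)
    (hA : ∀ X Y, IsSmooth X → IsSmooth Y → D.cov X (S.A.app Y) = S.A.app (D.cov X Y))
    (hBJ : S.B.IsIntegrable ∨ S.J.IsIntegrable) {ε : ℝ} (hε : ε * ε = 1) (hX : IsSmooth X)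
    (hY : IsSmooth Y) (hAX : S.A.app X = ε • X) (hAY : S.A.app Y = ε • Y) (x : M) :
    (S.averageB D).cov X Y x - (S.averageB D).cov Y X x = D.cov X Y x - D.cov Y X x := by
  have hBX := S.B_preservesSmooth X hX
  have hBY := S.B_preservesSmooth Y hY
  have hABX := app_B_eigen hAX
  have hABY := app_B_eigen hAY
  have ev {U V : VField E M} {c : ℝ} (hU : IsSmooth U) (hV : IsSmooth V) (hAV : S.A.app V = c • V) :
      S.A x (D.cov U V x) = c • D.cov U V x :=
    congrFun (cov_eigen_of_cov_A hA hU hV hAV) x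
  set u := bracket (S.B.app X) (S.B.app Y) x with hu
  set v := bracket X Y x with hv
  set w := D.cov X (S.B.app Y) x - D.cov Y (S.B.app X) x with hw
  set r := D.cov (S.B.app X) Y x - D.cov (S.B.app Y) X x with hr
  have hub : u = D.cov (S.B.app X) (S.B.app Y) x - D.cov (S.B.app Y) (S.B.app X) x :=
    hD.bracket_eq hBX hBY x
  have hvb : v = D.cov X Y x - D.cov Y X x := hD.bracket_eq hX hY x
  have hb1 : bracket (S.B.app X) Y x + bracket X (S.B.app Y) x = w + r := by
    rw [hD.bracket_eq hBX hY, hD.bracket_eq hX hBY, hw, hr]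
    abel
  have hAu : S.A x u = (-ε) • u := by
    rw [hub, map_sub, ev hBX hBY hABY, ev hBY hBX hABX, smul_sub]
  have hAv : S.A x v = ε • v := by
    rw [hvb, map_sub, ev hX hY hAY, ev hY hX hAX, smul_sub]
  have hAw : S.A x w = (-ε) • w := by
    rw [hw, map_sub, ev hX hBY hABY, ev hY hBX hABX, smul_sub]
  have hAr : S.A x r = ε • r := by
    rw [hr, map_sub, ev hBX hY hAY, ev hBY hX hAX, smul_sub]
  have hABw : S.A x (S.B x w) = ε • S.B x w := by
    have := S.B_A x w
    rw [hAw, map_smul] at this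
    linear_combination (norm := module) this
  have hABr : S.A x (S.B x r) = (-ε) • S.B x r := by
    have := S.B_A x r
    rw [hAr, map_smul] at this
    linear_combination (norm := module) this
  -- The vanishing Nijenhuis tensor, sorted by eigenbundle: `v` and `Bw` are of type `ε`, `u` and
  -- `Br` of type `-ε`. For `J` the sign flips, since `J` is `-εB` on type `ε` and `εB` on type `-ε`
  -- after `A` acts on the image. Both sides then lie in both eigenbundles.
  obtain ⟨c, key⟩ : ∃ c : ℝ, v - S.B x w = c • (S.B x r - u) := by
    rcases hBJ with hB | hJ
    · refine ⟨1, ?_⟩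
      have h := hB X Y hX hY x
      simp only [nijenhuis, S.B_B] at h
      have h2 := congrArg (S.B x) hb1
      simp only [map_add] at h2
      linear_combination (norm := module) h + h2
    · refine ⟨-1, ?_⟩
      have h := hJ X Y hX hY x
      have eX : S.J.app X = ε • S.B.app X := by
        funext y
        have := congrFun hABX y
        simp only [EndField.app, Pi.smul_apply] at this ⊢
        rw [S.J_eq, this, neg_smul, neg_neg]
      have eY : S.J.app Y = ε • S.B.app Y := by
        funext y
        have := congrFun hABY y
        simp only [EndField.app, Pi.smul_apply] at this ⊢
        rw [S.J_eq, this, neg_smul, neg_neg]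
      have h2 := congrArg (fun z ↦ S.J x (ε • z)) hb1
      simp only [map_add, map_smul, S.J_eq x w, S.J_eq x r, hABw, hABr] at h2
      simp only [nijenhuis, S.J_J, eX, eY, bracket_const_smul_left ε hBX,
        bracket_const_smul_right ε _ hBY, map_smul] at h
      rw [← hu, ← hv] at h
      have e1 : (ε * ε) • u = (1 : ℝ) • u := by rw [hε]
      have e2 : (ε * ε) • (S.B x w - S.B x r) = (1 : ℝ) • (S.B x w - S.B x r) := by rw [hε]
      linear_combination (norm := module) e1 + e2 - h - h2
  have h0 : v - S.B x w = 0 := by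
    refine eq_zero_of_eigen (S := S) hε ?_ ?_
    · rw [map_sub, hAv, hABw, smul_sub]
    · rw [key, map_smul, map_sub, hAu, hABr, smul_comm, smul_sub (-ε)]
  -- The averaged antisymmetrization is the mean of `[X, Y]` and `Bw`, which have just been shown
  -- equal.
  have e : (S.averageB D).cov X Y x - (S.averageB D).cov Y X x =
      (1 / 2 : ℝ) • (D.cov X Y x - D.cov Y X x + S.B x w) := by
    rw [hw, map_sub]
    simp only [averageB, AffineConnection.conjAverage_cov, Pi.smul_apply, Pi.add_apply,
      EndField.app]
    module
  rw [e, ← hvb, ← sub_eq_zero.1 h0]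
  module

/-- On an integrable Born structure, the Born connection is the average of the Levi-Civita
connection under `B`. -/
theorem isBornConnection_averageB [T2Space M] (hS : S.IsIntegrable)
    (hD : AffineConnection.IsLeviCivita S.g D) : S.IsBornConnection (S.averageB D) := by
  have hA : ∀ X Y, IsSmooth X → IsSmooth Y → D.cov X (S.A.app Y) = S.A.app (D.cov X Y) :=
    fun X Y hX hY ↦ cov_A hD hS.1 hS.A_isIntegrable hX hY
  have hc := isCompatible_averageB hD.1 hA
  have hBJ : S.B.IsIntegrable ∨ S.J.IsIntegrable := by
    rcases hS.2 with h | h | h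
    · exact .inl h.2
    · exact .inr h.2
    · exact .inl h.1
  refine ⟨hc, fun D' hD' X Y Z hX hY hZ x ↦ ?_⟩
  -- The canonical connection is the Levi-Civita connection itself, because the latter commutes with
  -- `A`.
  have hav {U V : VField E M} (hU : IsSmooth U) (hV : IsSmooth V) :
      D'.average S.A U V x = D.cov U V x := by
    have e := congrFun (cov_A hD' hS.1 hS.A_isIntegrable hU hV) x
    have e2 := congrFun (hD'.agree hD U V hU hV) x
    rw [AffineConnection.average, e, EndField.app, S.A_A, e2]
    module
  rw [hav hX hY, hav hY hX, hav hZ hX]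
  exact genTorsion_eq hc.1 hD.1 (fun X Y hX hY ↦ hc.1.cov_recursionOperator hc.2.2 hX hY) hA
    (fun ε hε X Y hX hY hAX hAY x ↦ averageB_torsion_eigen hD hA hBJ hε hX hY hAX hAY x) hX hY hZ x

/-- The Born connection is unique. -/
theorem IsBornConnection.agree [T2Space M] (hD : S.IsBornConnection D)
    (hD' : S.IsBornConnection D') : D.Agree D' := by
  have hA : ∀ X Y, IsSmooth X → IsSmooth Y → D.cov X (S.A.app Y) = S.A.app (D.cov X Y) :=
    fun X Y hX hY ↦ hD.1.1.cov_recursionOperator hD.1.2.2 hX hY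
  have hA' : ∀ X Y, IsSmooth X → IsSmooth Y → D'.cov X (S.A.app Y) = S.A.app (D'.cov X Y) :=
    fun X Y hX hY ↦ hD'.1.1.cov_recursionOperator hD'.1.2.2 hX hY
  have hB : ∀ X Y, IsSmooth X → IsSmooth Y → D.cov X (S.B.app Y) = S.B.app (D.cov X Y) :=
    fun X Y hX hY ↦ hD.1.1.cov_recursionOperator hD.1.2.1 hX hY
  have hB' : ∀ X Y, IsSmooth X → IsSmooth Y → D'.cov X (S.B.app Y) = S.B.app (D'.cov X Y) :=
    fun X Y hX hY ↦ hD'.1.1.cov_recursionOperator hD'.1.2.1 hX hY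
  have tor : ∀ X Y Z, IsSmooth X → IsSmooth Y → IsSmooth Z → ∀ x,
      S.genTorsion D X Y Z x = S.genTorsion D' X Y Z x := fun X Y Z hX hY hZ x ↦
    (hD.2 _ S.g.isLeviCivita_leviCivita X Y Z hX hY hZ x).trans
      (hD'.2 _ S.g.isLeviCivita_leviCivita X Y Z hX hY hZ x).symm
  have vanish : ∀ ε : ℝ, ε * ε = 1 → ∀ U V W : VField E M, IsSmooth U → IsSmooth V →
      S.A.app V = ε • V → S.A.app W = ε • W → ∀ x, S.g.val x (D.cov U V x) (W x) = 0 ∧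
        S.g.val x (D'.cov U V x) (W x) = 0 := fun ε hε U V W hU hV hAV hAW x ↦
    ⟨g_eq_zero_of_eigen hε (congrFun (cov_eigen_of_cov_A hA hU hV hAV) x) (congrFun hAW x),
      g_eq_zero_of_eigen hε (congrFun (cov_eigen_of_cov_A hA' hU hV hAV) x) (congrFun hAW x)⟩
  have sym : ∀ ε : ℝ, ε * ε = 1 → ∀ X Y : VField E M, IsSmooth X → IsSmooth Y →
      S.A.app X = ε • X → S.A.app Y = ε • Y →
        ∀ x, D.cov X Y x - D.cov Y X x = D'.cov X Y x - D'.cov Y X x := by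
    intro ε hε X Y hX hY hAX hAY x
    refine ext_eigen (S := S) hε ?_ ?_ <;> intro Z hZ hAZ
    · have h1 := vanish ε hε X Y Z hX hY hAY hAZ x
      have h2 := vanish ε hε Y X Z hY hX hAX hAZ x
      rw [map_sub, map_sub, sub_apply, sub_apply]
      linarith
    · have h1 := tor X Y Z hX hY hZ x
      have h2 := vanish ε hε Z X Y hZ hX hAX hAY x
      simp only [genTorsion] at h1
      linarith
  have same : ∀ ε : ℝ, ε * ε = 1 → ∀ X Y : VField E M, IsSmooth X → IsSmooth Y →
      S.A.app X = ε • X → S.A.app Y = ε • Y → D.cov X Y = D'.cov X Y := by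
    intro ε hε X Y hX hY hAX hAY
    funext x
    -- Both connections preserve `h = g(B·,·)`, so their difference is `h`-skew.
    have sk : ∀ U V W : VField E M, IsSmooth U → IsSmooth V → IsSmooth W →
        S.g.val x (D.cov U V x - D'.cov U V x) (S.B.app W x) =
          -S.g.val x (D.cov U W x - D'.cov U W x) (S.B.app V x) := by
      intro U V W hU hV hW
      have h := g_cov_add_swap hD.1.1 hD'.1.1 hU hV (S.B_preservesSmooth W hW) x
      rw [hB U W hU hW, hB' U W hU hW] at h
      simp only [EndField.app, S.g_B_left, map_sub, sub_apply] at h ⊢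
      linarith
    have sy : ∀ U V W : VField E M, IsSmooth U → IsSmooth V → S.A.app U = ε • U →
        S.A.app V = ε • V → S.g.val x (D.cov U V x - D'.cov U V x) (S.B.app W x) =
          S.g.val x (D.cov V U x - D'.cov V U x) (S.B.app W x) := by
      intro U V W hU hV hAU hAV
      have e : D.cov U V x - D'.cov U V x = D.cov V U x - D'.cov V U x := by
        linear_combination (norm := module) sym ε hε U V hU hV hAU hAV x
      rw [e]
    refine ext_eigen (S := S) hε ?_ ?_ <;> intro Z hZ hAZ
    · rw [(vanish ε hε X Y Z hX hY hAY hAZ x).1, (vanish ε hε X Y Z hX hY hAY hAZ x).2]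
    -- Write `Z = BW` with `W = BZ` in the `ε`-eigenbundle; then `sk` and `sy` alternate around `X`,
    -- `Y`, `W` to force zero.
    · have hAW : S.A.app (S.B.app Z) = ε • S.B.app Z := by simpa using app_B_eigen hAZ
      have hW := S.B_preservesSmooth Z hZ
      have h1 := sk X Y _ hX hY hW
      have h2 := sy X _ Y hX hW hAX hAW
      have h3 := sk _ X Y hW hX hY
      have h4 := sy _ Y X hW hY hAW hAY
      have h5 := sk Y _ X hY hW hX
      have h6 := sy Y X (S.B.app Z) hY hX hAY hAX
      have e : S.B.app (S.B.app Z) x = Z x := S.B_B x _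
      rw [e] at h1 h5 h6
      simp only [map_sub, sub_apply] at h1 h2 h3 h4 h5 h6
      linarith
  have mixed : ∀ ε : ℝ, ε * ε = 1 → ∀ X Y : VField E M, IsSmooth X → IsSmooth Y →
      S.A.app X = (-ε) • X → S.A.app Y = ε • Y → D.cov X Y = D'.cov X Y := by
    intro ε hε X Y hX hY hAX hAY
    have hε' : -ε * -ε = 1 := by simpa using hε
    -- `BY` lies in the same eigenbundle as `X`, and `B` is parallel for both connections.
    have h := same (-ε) hε' X _ hX (S.B_preservesSmooth Y hY) hAX (app_B_eigen hAY)
    rw [hB X Y hX hY, hB' X Y hX hY] at h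
    funext x
    have := congrArg (S.B x) (congrFun h x)
    simpa only [EndField.app, S.B_B] using this
  have step : ∀ ε : ℝ, ε * ε = 1 → ∀ X Y : VField E M, IsSmooth X → IsSmooth Y →
      S.A.app Y = ε • Y → D.cov X Y = D'.cov X Y := by
    intro ε hε X Y hX hY hAY
    refine eigen_induction (S := S) (p := fun X ↦ D.cov X Y = D'.cov X Y) ε hε
      (fun X hX hAX ↦ same ε hε X Y hX hY hAX hAY)
      (fun X hX hAX ↦ mixed ε hε X Y hX hY hAX hAY) ?_ hX
    intro X X' _ _ h h'
    rw [D.cov_add_left, D'.cov_add_left, h, h']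
  intro X Y hX hY
  refine eigen_induction (S := S) (p := fun Y ↦ D.cov X Y = D'.cov X Y) 1 (by norm_num)
    (fun Y hY ↦ step 1 (by norm_num) X Y hX hY) (fun Y hY ↦ step (-1) (by norm_num) X Y hX hY)
    ?_ hY
  intro Y Y' hY hY' h h'
  rw [AffineConnection.cov_add_right _ hY hY', AffineConnection.cov_add_right _ hY hY', h, h']

/-- With `J = -AB` and `∇` commuting with `A`: `J∇J = AB∇AB = ABA∇B = -B∇B`. -/
theorem averageB_cov_eq_J [T2Space M] (hX : IsSmooth X) (hY : IsSmooth Y)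
    (hA : ∀ X Y, IsSmooth X → IsSmooth Y → D.cov X (S.A.app Y) = S.A.app (D.cov X Y)) (x : M) :
    (S.averageB D).cov X Y x =
      (1 / 2 : ℝ) • (D.cov X Y x - S.J x (D.cov X (S.J.app Y) x)) := by
  have hBY := S.B_preservesSmooth Y hY
  have eJ : S.J.app Y = -S.A.app (S.B.app Y) := funext fun y ↦ S.J_eq y _
  rw [eJ, AffineConnection.cov_neg_right _ (S.A_preservesSmooth _ hBY), hA X _ hX hBY,
    Pi.neg_apply, map_neg, S.J_eq, neg_neg]
  simp only [EndField.app, S.B_A, S.A_A, map_neg, sub_neg_eq_add]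
  rfl

end BornStructure

end BornConnection

end BornGeometry

end

theorem mainTheorem1 {E : Type*} [NormedAddCommGroup E] [NormedSpace ℝ E] [FiniteDimensional ℝ E]
    {M : Type*} [TopologicalSpace M] [T2Space M] [SigmaCompactSpace M] [ChartedSpace E M]
    [IsManifold 𝓘(ℝ, E) ∞ M]
    (S : BornGeometry.BornStructure E M) (hS : S.IsIntegrable) :
    -- the Levi-Civita, Künneth and Born connections exist and are unique
    BornGeometry.AffineConnection.ExistsUnique
        (BornGeometry.AffineConnection.IsLeviCivita S.g) ∧
      BornGeometry.AffineConnection.ExistsUnique S.IsKunnethConnection ∧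
      BornGeometry.AffineConnection.ExistsUnique S.IsBornConnection ∧
      -- the Born connection is the averaged Künneth connection
      ∀ DK DB : BornGeometry.AffineConnection E M,
        S.IsKunnethConnection DK → S.IsBornConnection DB →
          ∀ X Y : BornGeometry.VField E M, BornGeometry.IsSmooth X → BornGeometry.IsSmooth Y →
            ∀ x : M,
              DB.cov X Y x =
                (1 / 2 : ℝ) • (DK.cov X Y x + S.B x (DK.cov X (S.B.app Y) x)) ∧
              DB.cov X Y x =
                (1 / 2 : ℝ) • (DK.cov X Y x - S.J x (DK.cov X (S.J.app Y) x)) := by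
  have hA := hS.A_isIntegrable
  have hg := S.g.isLeviCivita_leviCivita
  have hK := BornGeometry.BornStructure.isKunnethConnection_of_isLeviCivita hg hS.1 hA
  have hB := BornGeometry.BornStructure.isBornConnection_averageB hS hg
  refine ⟨S.g.existsUnique_leviCivita, ⟨_, hK, fun _ hD ↦ hD.agree hK⟩,
    ⟨_, hB, fun _ hD ↦ hD.agree hB⟩, fun DK DB hDK hDB X Y hX hY x ↦ ?_⟩
  have hY' := S.B_preservesSmooth Y hY
  have eJ : BornGeometry.IsSmooth (S.J.app Y) := S.J_preservesSmooth Y hY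
  -- Uniqueness replaces the given connections by the Levi-Civita connection and its average, where
  -- the first formula is definitional.
  rw [hDK.agree hK X Y hX hY, hDK.agree hK X _ hX hY', hDK.agree hK X _ hX eJ,
    hDB.agree hB X Y hX hY]
  exact ⟨rfl, BornGeometry.BornStructure.averageB_cov_eq_J hX hY
    (fun X Y hX hY ↦ BornGeometry.BornStructure.cov_A hg hS.1 hA hX hY) x⟩
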